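/- Let $d\ge 0$ and $m\ge 1$ be integers and let $V:\mathbb{R}^d\to\mathbb{R}$ be of class $C^{m-1}$ such that $V$ and all its partial derivatives of order $<m$ are bounded. Let $H=-\Delta+V$ on $L^2(\mathbb{R}^d)$ with domain $H^2(\mathbb{R}^d)$, where $\Delta=\sum_j\partial_{x_j}^2$. Let $D(H^0)=L^2(\mathbb{R}^d)$ and $D(H^{k+1})=\{\psi\in D(H): H\psi\in D(H^k)\}$. For $\psi\in L^2(\mathbb{R}^d)$ write $x^m\psi(x)=(x_1^m\psi(x),\dots,x_d^m\psi(x))$ and $\|x^m\psi\|=\bigl(\sum_{j=1}^d\int_{\mathbb{R}^d}|x_j^m\psi(x)|^2\,dx\bigr)^{1/2}\in[0,\infty]$. Then $-iH$ generates a strongly continuous one-parameter unitary group $(e^{-itH})_{t\in\mathbb{R}}$ on $L^2(\mathbb{R}^d)$, and there is a constant $C_m\ge 0$, depending only on $m$, $d$ and $V$, such that for every $\psi\in H^{2m}(\mathbb{R}^d)$ and every $t\ge 0$, $$\|x^m e^{-itH}\psi\|\le 2^{m-1}\Bigl(\|x^m\psi\|+C_m t^m\sum_{\substack{0\le k\le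 m\\ \psi\in D(H^k)}}\|H^k\psi\|\Bigr).$$ If $\psi\in D(H^m)$, the sum is the full sum $\sum_{k=0}^m\|H^k\psi\|$. The inequality is one in $[0,\infty]$; in particular $\|x^me^{-itH}\psi\|<\infty$ for all $t\ge 0$ if $\|x^m\psi\|<\infty$. -/

import Mathlib

open MeasureTheory
open scoped ENNReal SchwartzMap Laplacian

noncomputable section

/-- The configuration space `ℝ^d` with its Euclidean norm. -/
abbrev Rd (d : ℕ) : Type := EuclideanSpace ℝ (Fin d)

/-- The Hilbert space `L²(ℝ^d)` of complex-valued functions. -/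
abbrev L2Rd (d : ℕ) : Type := Lp ℂ 2 (volume : Measure (Rd d))

/-- `ψ ∈ H^s(ℝ^d)`, the `L²`-based Sobolev space of order `s`. -/
def InSobolev {d : ℕ} (s : ℝ) (ψ : L2Rd d) : Prop :=
  TemperedDistribution.MemSobolev s 2 (ψ : 𝓢'(Rd d, ℂ))

/-- An `L²` function is determined by the tempered distribution it defines. -/
theorem L2Rd.ext_distribution {d : ℕ} {f g : L2Rd d}
    (h : (f : 𝓢'(Rd d, ℂ)) = (g : 𝓢'(Rd d, ℂ))) : f = g :=
  LinearMap.ker_eq_bot.mp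
    (Lp.ker_toTemperedDistributionCLM_eq_bot (F := ℂ) (μ := (volume : Measure (Rd d))) (p := 2)) h

/-- The distributional Laplacian of an `H²` function is an `L²` function. -/
theorem InSobolev.exists_laplacian {d : ℕ} {ψ : L2Rd d} (h : InSobolev 2 ψ) :
    ∃ φ : L2Rd d, Δ (ψ : 𝓢'(Rd d, ℂ)) = (φ : 𝓢'(Rd d, ℂ)) := by
  have h1 := TemperedDistribution.MemSobolev.laplacian h
  rw [sub_self] at h1
  exact TemperedDistribution.memSobolev_zero_iff.mp h1

/-- The Laplacian `Δψ ∈ L²(ℝ^d)` of `ψ ∈ H²(ℝ^d)`, in the sense of distributions. -/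
def laplacianL2 {d : ℕ} (ψ : L2Rd d) (h : InSobolev 2 ψ) : L2Rd d :=
  h.exists_laplacian.choose

theorem laplacianL2_spec {d : ℕ} (ψ : L2Rd d) (h : InSobolev 2 ψ) :
    Δ (ψ : 𝓢'(Rd d, ℂ)) = (laplacianL2 ψ h : 𝓢'(Rd d, ℂ)) :=
  h.exists_laplacian.choose_spec

theorem InSobolev.add {d : ℕ} {s : ℝ} {ψ φ : L2Rd d} (hψ : InSobolev s ψ) (hφ : InSobolev s φ) :
    InSobolev s (ψ + φ) := by
  have h := TemperedDistribution.MemSobolev.add hψ hφ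
  rw [← Lp.toTemperedDistributionCLM_apply ψ, ← Lp.toTemperedDistributionCLM_apply φ,
    ← map_add] at h
  exact h

theorem InSobolev.smul {d : ℕ} {s : ℝ} {ψ : L2Rd d} (c : ℂ) (hψ : InSobolev s ψ) :
    InSobolev s (c • ψ) := by
  have h := TemperedDistribution.MemSobolev.smul c hψ
  rw [← Lp.toTemperedDistributionCLM_apply ψ, ← map_smul] at h
  exact h

theorem inSobolev_zero {d : ℕ} (s : ℝ) : InSobolev s (0 : L2Rd d) := by
  have h := TemperedDistribution.memSobolev_fun_zero (Rd d) ℂ s 2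
  rw [← map_zero (Lp.toTemperedDistributionCLM ℂ (volume : Measure (Rd d)) 2)] at h
  exact h

theorem laplacianL2_add {d : ℕ} {ψ φ : L2Rd d} (hψ : InSobolev 2 ψ) (hφ : InSobolev 2 φ)
    (h : InSobolev 2 (ψ + φ)) :
    laplacianL2 (ψ + φ) h = laplacianL2 ψ hψ + laplacianL2 φ hφ := by
  apply L2Rd.ext_distribution
  rw [← laplacianL2_spec]
  have e : ∀ a b : L2Rd d, ((a + b : L2Rd d) : 𝓢'(Rd d, ℂ)) = (a : 𝓢'(Rd d, ℂ)) + b :=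
    fun a b => map_add (Lp.toTemperedDistributionCLM ℂ (volume : Measure (Rd d)) 2) a b
  rw [e, e, ← laplacianL2_spec, ← laplacianL2_spec,
    ← TemperedDistribution.laplacianCLM_apply, map_add,
    TemperedDistribution.laplacianCLM_apply, TemperedDistribution.laplacianCLM_apply]

theorem laplacianL2_smul {d : ℕ} {ψ : L2Rd d} (c : ℂ) (hψ : InSobolev 2 ψ)
    (h : InSobolev 2 (c • ψ)) :
    laplacianL2 (c • ψ) h = c • laplacianL2 ψ hψ := by
  apply L2Rd.ext_distribution
  rw [← laplacianL2_spec]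
  have e : ∀ a : L2Rd d, ((c • a : L2Rd d) : 𝓢'(Rd d, ℂ)) = c • (a : 𝓢'(Rd d, ℂ)) :=
    fun a => map_smul (Lp.toTemperedDistributionCLM ℂ (volume : Measure (Rd d)) 2) c a
  rw [e, e, ← laplacianL2_spec, ← TemperedDistribution.laplacianCLM_apply, map_smul,
    TemperedDistribution.laplacianCLM_apply]

/-- `Vψ` is square integrable. -/
def MulMemL2 {d : ℕ} (V : Rd d → ℝ) (ψ : L2Rd d) : Prop :=
  MemLp (fun x => (V x : ℂ) * ψ x) 2 (volume : Measure (Rd d))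

theorem mul_add_ae {d : ℕ} (V : Rd d → ℝ) (ψ φ : L2Rd d) :
    (fun x => (V x : ℂ) * (ψ + φ : L2Rd d) x) =ᵐ[volume]
      (fun x => (V x : ℂ) * ψ x) + fun x => (V x : ℂ) * φ x := by
  filter_upwards [Lp.coeFn_add ψ φ] with x hx
  simp only [hx, Pi.add_apply, mul_add]

theorem mul_smul_ae {d : ℕ} (V : Rd d → ℝ) (c : ℂ) (ψ : L2Rd d) :
    (fun x => (V x : ℂ) * (c • ψ : L2Rd d) x) =ᵐ[volume]
      c • fun x => (V x : ℂ) * ψ x := by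
  filter_upwards [Lp.coeFn_smul c ψ] with x hx
  simp only [hx, Pi.smul_apply, smul_eq_mul]
  ring

theorem MulMemL2.add {d : ℕ} {V : Rd d → ℝ} {ψ φ : L2Rd d} (hψ : MulMemL2 V ψ)
    (hφ : MulMemL2 V φ) : MulMemL2 V (ψ + φ) :=
  (memLp_congr_ae (mul_add_ae V ψ φ)).mpr (MemLp.add hψ hφ)

theorem MulMemL2.smul {d : ℕ} {V : Rd d → ℝ} {ψ : L2Rd d} (c : ℂ) (hψ : MulMemL2 V ψ) :
    MulMemL2 V (c • ψ) :=
  (memLp_congr_ae (mul_smul_ae V c ψ)).mpr (MemLp.const_smul hψ c)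

theorem mulMemL2_zero {d : ℕ} (V : Rd d → ℝ) : MulMemL2 V (0 : L2Rd d) := by
  refine (memLp_congr_ae ?_).mpr (MemLp.zero (ε := ℂ))
  filter_upwards [Lp.coeFn_zero ℂ 2 (volume : Measure (Rd d))] with x hx
  rw [hx]
  simp

/-- The Schrödinger operator `H = -Δ + V` on `L²(ℝ^d)`, as an unbounded operator with domain
`{ψ ∈ H²(ℝ^d) | Vψ ∈ L²(ℝ^d)}`; for bounded measurable `V` the domain is `H²(ℝ^d)`. -/
def schrodingerOp {d : ℕ} (V : Rd d → ℝ) : L2Rd d →ₗ.[ℂ] L2Rd d where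
  domain :=
    { carrier := {ψ | InSobolev 2 ψ ∧ MulMemL2 V ψ}
      add_mem' := fun ha hb => ⟨ha.1.add hb.1, ha.2.add hb.2⟩
      zero_mem' := ⟨inSobolev_zero 2, mulMemL2_zero V⟩
      smul_mem' := fun c _ h => ⟨h.1.smul c, h.2.smul c⟩ }
  toFun :=
    { toFun := fun ψ => -laplacianL2 (ψ : L2Rd d) ψ.2.1 +
        MemLp.toLp (fun x => (V x : ℂ) * (ψ : L2Rd d) x) ψ.2.2
      map_add' := by
        rintro ⟨ψ, hψ⟩ ⟨φ, hφ⟩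
        have h1 := laplacianL2_add hψ.1 hφ.1 (hψ.1.add hφ.1)
        have h2 := MemLp.toLp_congr (hψ.2.add hφ.2) (MemLp.add hψ.2 hφ.2) (mul_add_ae V ψ φ)
        rw [MemLp.toLp_add hψ.2 hφ.2] at h2
        change -laplacianL2 (ψ + φ) _ + MemLp.toLp (fun x => (V x : ℂ) * (ψ + φ : L2Rd d) x) _ = _
        rw [h1, h2]
        abel
      map_smul' := by
        rintro c ⟨ψ, hψ⟩
        have h1 := laplacianL2_smul c hψ.1 (hψ.1.smul c)
        have h2 := MemLp.toLp_congr (hψ.2.smul c) (MemLp.const_smul hψ.2 c) (mul_smul_ae V c ψ)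
        rw [MemLp.toLp_const_smul c hψ.2] at h2
        change -laplacianL2 (c • ψ) _ + MemLp.toLp (fun x => (V x : ℂ) * (c • ψ : L2Rd d) x) _ = _
        rw [h1, h2, RingHom.id_apply, smul_add, smul_neg] }

/-- The domain of the `k`-th power of an unbounded operator `A`:
`D(A⁰)` is the whole space and `D(A^{k+1}) = {ψ ∈ D(A) | Aψ ∈ D(A^k)}`. -/
def powDomain {𝓗 : Type*} [NormedAddCommGroup 𝓗] [InnerProductSpace ℂ 𝓗] (A : 𝓗 →ₗ.[ℂ] 𝓗) :
    ℕ → Set 𝓗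
  | 0 => Set.univ
  | k + 1 => {ψ | ∃ h : ψ ∈ A.domain, A ⟨ψ, h⟩ ∈ powDomain A k}

/-- The vector `A^k ψ` for `ψ ∈ D(A^k)`. -/
def powApply {𝓗 : Type*} [NormedAddCommGroup 𝓗] [InnerProductSpace ℂ 𝓗] (A : 𝓗 →ₗ.[ℂ] 𝓗) :
    (k : ℕ) → (ψ : 𝓗) → ψ ∈ powDomain A k → 𝓗
  | 0, ψ, _ => ψ
  | k + 1, ψ, h => powApply A k (A ⟨ψ, h.choose⟩) h.choose_spec

open Classical in
/-- The sum `∑ ‖A^k ψ‖` over those `k ≤ m` for which `ψ ∈ D(A^k)`.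
If `ψ ∈ D(A^m)` this is the full sum over `0 ≤ k ≤ m`. -/
def sumNormPow {𝓗 : Type*} [NormedAddCommGroup 𝓗] [InnerProductSpace ℂ 𝓗] (A : 𝓗 →ₗ.[ℂ] 𝓗)
    (m : ℕ) (ψ : 𝓗) : ℝ :=
  ∑ k ∈ Finset.range (m + 1), if h : ψ ∈ powDomain A k then ‖powApply A k ψ h‖ else 0

/-- `U` is a strongly continuous one-parameter group of unitary operators whose infinitesimal
generator is exactly `-iA`: the map `t ↦ U t ψ` is differentiable at `0` precisely when `ψ` lies in
the domain of `A`, and its derivative there is `-iAψ`. Such a `U` is unique, and by Stone's theorem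
it exists precisely when `A` is self-adjoint; it is then `U t = e^{-itA}`. -/
structure IsUnitaryGroupOf {𝓗 : Type*} [NormedAddCommGroup 𝓗] [InnerProductSpace ℂ 𝓗]
    (A : 𝓗 →ₗ.[ℂ] 𝓗) (U : ℝ → (𝓗 ≃ₗᵢ[ℂ] 𝓗)) : Prop where
  map_zero : ∀ ψ, U 0 ψ = ψ
  map_add : ∀ s t ψ, U (s + t) ψ = U s (U t ψ)
  continuous : ∀ ψ, Continuous fun t => U t ψ
  generator : ∀ ψ φ, HasDerivAt (fun t => U t ψ) (-(Complex.I • φ)) 0 ↔ (ψ, φ) ∈ A.graph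

open Classical in
/-- The unitary group `t ↦ e^{-itA}` generated by `-iA` (a dummy value if there is none). -/
def unitaryGroup {𝓗 : Type*} [NormedAddCommGroup 𝓗] [InnerProductSpace ℂ 𝓗]
    (A : 𝓗 →ₗ.[ℂ] 𝓗) : ℝ → (𝓗 ≃ₗᵢ[ℂ] 𝓗) :=
  if h : ∃ U, IsUnitaryGroupOf A U then h.choose else fun _ => LinearIsometryEquiv.refl ℂ 𝓗

/-- The norm `‖x^m ψ‖ ∈ [0, ∞]` of the `ℂ^d`-valued function
`x^m ψ(x) = (x₁^m ψ(x), …, x_d^m ψ(x))`, that is `(∑ⱼ ∫ |xⱼ^m ψ(x)|² dx)^{1/2}`. -/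
def momentNorm {d : ℕ} (m : ℕ) (ψ : L2Rd d) : ℝ≥0∞ :=
  eLpNorm (fun x : Rd d => (WithLp.toLp 2 fun j => ((x j : ℂ) ^ m * ψ x) : EuclideanSpace ℂ (Fin d)))
    2 volume

end

open Filter Topology
open scoped BoundedContinuousFunction FourierTransform

/-! ### Multiplication operators on `L²` -/

/-! The estimate comes from a differential inequality for a bounded weight, uniform in the cut-off.
Put `m = n + 1`, fix a coordinate `j`, and replace `x_j` by `w = δ⁻¹ tanh (δ x_j)` with `0 < δ ≤ 1`.
Let `F(t) = ‖w^m e^{-itH}ψ‖²`. In `F'` the potential drops out because it is real, and the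
directions other than `j` drop out because `w` depends on `x_j` only. The single commutator term
that is left gives `F' ≤ 4m ‖w^m u‖ ‖w^n ∂_j u‖` with `u = e^{-itH}ψ`
(`abs_im_inner_schrodinger_le`).

The mixed norm is interpolated between pure weight and pure regularity: `‖w^n ∂_j u‖^m ≤ C ‖w^m u‖^n
∑_{l ≤ m} ‖∂_j^l u‖`, with `C` independent of `δ`. Integration by parts
(`IsTanhWeight.norm_sq_deriv_le`, `IsTanhWeight.uncertainty`) makes suitable sums of the norms `‖w^r
∂_j^l u‖` log-convex along the diagonal `r + l = m`, and the rest is a statement about sequences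
(`exists_interpolation`).

The regularity factor is bounded uniformly in time. By elliptic regularity for `1 - Δ` the Sobolev
norm of order `2k` is controlled by `∑_{i ≤ k} ‖H^i u‖` when `V` has `2k - 2` bounded derivatives
(`exists_sobolevBound_of_mem_powDomain`), and the group preserves each `‖H^i u‖`. One takes `k =
⌈m/2⌉`: then `2k - 2 ≤ m - 1` matches the smoothness of `V`, and `ψ ∈ H^{2m}` lies in `D(H^k)`
although it need not lie in `D(H^m)`.

Hence `F^{1/(2m)}` grows at most linearly (`sqrt_le_of_deriv_le`), and `(a + b)^m ≤ 2^{m-1}(a^m +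
b^m)` produces the factor `2^{m-1}`. Fatou's lemma removes `δ`, and Minkowski's inequality combines
the coordinates.

For the group itself, `e^{itΔ}` is a unimodular Fourier multiplier, and the bounded potential is
added by solving the equation of the interaction picture with a Dyson series. -/

theorem memLp_boundedContinuous_mul {d : ℕ} (g : Rd d →ᵇ ℂ) (u : L2Rd d) :
    MemLp (fun x => g x * u x) 2 (volume : Measure (Rd d)) :=
  (Lp.memLp u).of_le_mul (c := ‖g‖)
    (g.continuous.aestronglyMeasurable.mul (Lp.aestronglyMeasurable u))
    (Eventually.of_forall fun x => by
      rw [norm_mul]; exact mul_le_mul_of_nonneg_right (g.norm_coe_le_norm x) (norm_nonneg _))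

/-- Multiplication by a bounded continuous function, as a bounded operator on `L²`. -/
noncomputable def mulOp {d : ℕ} (g : Rd d →ᵇ ℂ) : L2Rd d →L[ℂ] L2Rd d :=
  LinearMap.mkContinuous
    { toFun := fun u => (memLp_boundedContinuous_mul g u).toLp
      map_add' := fun u v => by
        rw [← MemLp.toLp_add]
        refine MemLp.toLp_congr _ _ ?_
        filter_upwards [Lp.coeFn_add u v] with x hx
        simp only [hx, Pi.add_apply, mul_add]
      map_smul' := fun c u => by
        rw [RingHom.id_apply, ← MemLp.toLp_const_smul]
        refine MemLp.toLp_congr _ _ ?_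
        filter_upwards [Lp.coeFn_smul c u] with x hx
        simp only [hx, Pi.smul_apply, smul_eq_mul]
        ring }
    ‖g‖ (fun u => by
      refine Lp.norm_le_mul_norm_of_ae_le_mul ?_
      filter_upwards [(memLp_boundedContinuous_mul g u).coeFn_toLp] with x hx
      change ‖((memLp_boundedContinuous_mul g u).toLp _ : L2Rd d) x‖ ≤ _
      rw [hx, norm_mul]
      exact mul_le_mul_of_nonneg_right (g.norm_coe_le_norm x) (norm_nonneg _))

theorem coeFn_mulOp {d : ℕ} (g : Rd d →ᵇ ℂ) (u : L2Rd d) :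
    mulOp g u =ᵐ[volume] fun x => g x * u x :=
  (memLp_boundedContinuous_mul g u).coeFn_toLp

theorem mulOp_eq_of_ae {d : ℕ} {g : Rd d →ᵇ ℂ} {u v : L2Rd d}
    (h : ∀ᵐ x, v x = g x * u x) : mulOp g u = v := by
  apply Lp.ext
  filter_upwards [coeFn_mulOp g u, h] with x h1 h2
  rw [h1, h2]

theorem mulOp_mul {d : ℕ} (g h : Rd d →ᵇ ℂ) (u : L2Rd d) :
    mulOp (g * h) u = mulOp g (mulOp h u) := by
  apply mulOp_eq_of_ae
  filter_upwards [coeFn_mulOp g (mulOp h u), coeFn_mulOp h u] with x h1 h2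
  rw [h1, h2, BoundedContinuousFunction.mul_apply, mul_assoc]

theorem mulOp_comm {d : ℕ} (g h : Rd d →ᵇ ℂ) (u : L2Rd d) :
    mulOp g (mulOp h u) = mulOp h (mulOp g u) := by
  rw [← mulOp_mul, ← mulOp_mul, mul_comm]

theorem mulOp_one {d : ℕ} (u : L2Rd d) : mulOp (1 : Rd d →ᵇ ℂ) u = u :=
  mulOp_eq_of_ae (Eventually.of_forall fun x => by simp)

theorem mulOp_add {d : ℕ} (g h : Rd d →ᵇ ℂ) (u : L2Rd d) :
    mulOp (g + h) u = mulOp g u + mulOp h u := by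
  apply mulOp_eq_of_ae
  filter_upwards [coeFn_mulOp g u, coeFn_mulOp h u, Lp.coeFn_add (mulOp g u) (mulOp h u)]
    with x h1 h2 h3
  rw [h3, Pi.add_apply, h1, h2, BoundedContinuousFunction.add_apply, add_mul]

theorem mulOp_smul {d : ℕ} (c : ℂ) (g : Rd d →ᵇ ℂ) (u : L2Rd d) :
    mulOp (c • g) u = c • mulOp g u := by
  apply mulOp_eq_of_ae
  filter_upwards [coeFn_mulOp g u, Lp.coeFn_smul c (mulOp g u)] with x h1 h3
  rw [h3, Pi.smul_apply, h1, BoundedContinuousFunction.smul_apply, smul_eq_mul, smul_eq_mul,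
    mul_assoc]

theorem norm_mulOp_le_mul {d : ℕ} {g h : Rd d →ᵇ ℂ} {c : ℝ} (hc : ∀ x, ‖g x‖ ≤ c * ‖h x‖)
    (u : L2Rd d) : ‖mulOp g u‖ ≤ c * ‖mulOp h u‖ := by
  refine Lp.norm_le_mul_norm_of_ae_le_mul ?_
  filter_upwards [coeFn_mulOp g u, coeFn_mulOp h u] with x h1 h2
  rw [h1, h2, norm_mul, norm_mul, ← mul_assoc]
  exact mul_le_mul_of_nonneg_right (hc x) (norm_nonneg _)

theorem norm_mulOp_le {d : ℕ} {g : Rd d →ᵇ ℂ} {c : ℝ} (hc : ∀ x, ‖g x‖ ≤ c)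
    (u : L2Rd d) : ‖mulOp g u‖ ≤ c * ‖u‖ := by
  have := norm_mulOp_le_mul (g := g) (h := 1) (c := c) (fun x => by simpa using hc x) u
  rwa [mulOp_one] at this

theorem inner_mulOp_left {d : ℕ} (g : Rd d →ᵇ ℂ) (u v : L2Rd d) :
    inner ℂ (mulOp g u) v = inner ℂ u (mulOp (star g) v) := by
  rw [L2.inner_def, L2.inner_def]
  apply integral_congr_ae
  filter_upwards [coeFn_mulOp g u, coeFn_mulOp (star g) v] with x h1 h2
  rw [h1, h2]
  simp
  ring

theorem L2Rd.norm_sq_eq {d : ℕ} (u : L2Rd d) : ‖u‖ ^ 2 = ∫ x, ‖u x‖ ^ 2 := by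
  have h := inner_self_eq_norm_sq_to_K (𝕜 := ℂ) u
  rw [L2.inner_def] at h
  simp only [inner_self_eq_norm_sq_to_K] at h
  norm_cast at h
  exact h.symm

/-- Dominated convergence in `L²`. -/
theorem L2Rd.tendsto_zero_of_dominated {d : ℕ} {ι : Type*} {l : Filter ι}
    [l.IsCountablyGenerated] {f : ι → L2Rd d} {G : ι → Rd d → ℂ} {b : Rd d → ℝ}
    (hb : MemLp b 2 volume) (hf : ∀ n, f n =ᵐ[volume] G n)
    (hG : ∀ᶠ n in l, ∀ᵐ x, ‖G n x‖ ≤ b x)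
    (hlim : ∀ᵐ x, Tendsto (fun n => G n x) l (𝓝 0)) : Tendsto f l (𝓝 0) := by
  have key : Tendsto (fun n => ∫ x, ‖G n x‖ ^ 2) l (𝓝 (∫ x : Rd d, (0 : ℝ))) := by
    refine tendsto_integral_filter_of_dominated_convergence (fun x => b x ^ 2) ?_ ?_
      hb.integrable_sq ?_
    · refine Eventually.of_forall fun n => ?_
      have := (Lp.aestronglyMeasurable (f n)).congr (hf n)
      exact this.norm.pow 2
    · filter_upwards [hG] with n hn
      filter_upwards [hn] with x hx
      rw [norm_pow, norm_norm]
      gcongr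
    · filter_upwards [hlim] with x hx
      simpa using (hx.norm.pow 2)
  rw [integral_zero] at key
  have h2 : Tendsto (fun n => ‖f n‖ ^ 2) l (𝓝 0) := by
    refine key.congr fun n => ?_
    rw [L2Rd.norm_sq_eq]
    apply integral_congr_ae
    filter_upwards [hf n] with x hx
    rw [hx]
  rw [tendsto_zero_iff_norm_tendsto_zero]
  have h3 := h2.sqrt
  simpa [Real.sqrt_sq] using h3

/-! ### Groups of unimodular multiplications -/

/-- The bounded continuous function `exp(iφ)`. -/
noncomputable def phase {d : ℕ} (φ : C(Rd d, ℝ)) : Rd d →ᵇ ℂ :=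
  BoundedContinuousFunction.ofNormedAddCommGroup (fun x => Complex.exp (φ x * Complex.I))
    (by fun_prop) 1 (fun x => by rw [Complex.norm_exp_ofReal_mul_I])

theorem phase_apply {d : ℕ} (φ : C(Rd d, ℝ)) (x : Rd d) :
    phase φ x = Complex.exp (φ x * Complex.I) := rfl

theorem phase_add {d : ℕ} (φ χ : C(Rd d, ℝ)) : phase (φ + χ) = phase φ * phase χ := by
  ext x
  simp [phase_apply, add_mul, Complex.exp_add]

theorem phase_zero {d : ℕ} : phase (0 : C(Rd d, ℝ)) = 1 := by
  ext x
  simp [phase_apply]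

theorem norm_mulOp_phase {d : ℕ} (φ : C(Rd d, ℝ)) (u : L2Rd d) : ‖mulOp (phase φ) u‖ = ‖u‖ := by
  apply le_antisymm
  · simpa using norm_mulOp_le (g := phase φ) (c := 1)
      (fun x => by rw [phase_apply, Complex.norm_exp_ofReal_mul_I]) u
  · have := norm_mulOp_le_mul (g := 1) (h := phase φ) (c := 1)
      (fun x => by simp [phase_apply, Complex.norm_exp_ofReal_mul_I]) u
    simpa [mulOp_one] using this

theorem tendsto_mulOp_phase {d : ℕ} (φ : C(Rd d, ℝ)) (u : L2Rd d) :
    Tendsto (fun t : ℝ => mulOp (phase (t • φ)) u) (𝓝 0) (𝓝 u) := by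
  rw [← tendsto_sub_nhds_zero_iff]
  refine L2Rd.tendsto_zero_of_dominated (b := fun x => 2 * ‖u x‖)
    (G := fun t x => (phase (t • φ) x - 1) * u x) ((Lp.memLp u).norm.const_mul 2) ?_ ?_ ?_
  · intro t
    filter_upwards [coeFn_mulOp (phase (t • φ)) u, Lp.coeFn_sub (mulOp (phase (t • φ)) u) u]
      with x h1 h2
    rw [h2, Pi.sub_apply, h1, sub_mul, one_mul]
  · refine Eventually.of_forall fun t => Eventually.of_forall fun x => ?_
    rw [norm_mul]
    gcongr
    refine (norm_sub_le _ _).trans ?_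
    rw [phase_apply, Complex.norm_exp_ofReal_mul_I, norm_one]
    norm_num
  · refine Eventually.of_forall fun x => ?_
    have : Continuous fun t : ℝ => (phase (t • φ) x - 1) * u x := by
      simp only [phase_apply, ContinuousMap.smul_apply, smul_eq_mul, Complex.ofReal_mul]
      fun_prop
    have h := this.tendsto 0
    simpa [phase_apply] using h

theorem hasDerivAt_mulOp_phase_of_ae {d : ℕ} (φ : C(Rd d, ℝ)) {u v : L2Rd d}
    (h : ∀ᵐ x, v x = (φ x * Complex.I) * u x) :
    HasDerivAt (fun t : ℝ => mulOp (phase (t • φ)) u) v 0 := by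
  rw [hasDerivAt_iff_tendsto_slope_zero, ← tendsto_sub_nhds_zero_iff]
  refine L2Rd.tendsto_zero_of_dominated (b := fun x => 3 * ‖v x‖)
    (G := fun t x => ((t⁻¹ : ℝ) * (phase (t • φ) x - 1) - φ x * Complex.I) * u x)
    ((Lp.memLp v).norm.const_mul 3) ?_ ?_ ?_
  · intro t
    simp only [zero_add, zero_smul, phase_zero, mulOp_one]
    filter_upwards [coeFn_mulOp (phase (t • φ)) u, Lp.coeFn_sub (mulOp (phase (t • φ)) u) u, h,
      Lp.coeFn_smul t⁻¹ (mulOp (phase (t • φ)) u - u),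
      Lp.coeFn_sub (t⁻¹ • (mulOp (phase (t • φ)) u - u)) v] with x h1 h2 h3 h4 h5
    rw [h5, Pi.sub_apply, h4, Pi.smul_apply, h2, Pi.sub_apply, h1, h3, Complex.real_smul]
    ring
  · filter_upwards [self_mem_nhdsWithin] with t ht
    filter_upwards [h] with x hx
    have e1 : ‖phase (t • φ) x - 1‖ ≤ |t| * |φ x| := by
      have := Real.norm_exp_I_mul_ofReal_sub_one_le (x := t * φ x)
      rw [phase_apply]
      simpa [mul_comm, abs_mul] using this
    have ht' : 0 < |t| := abs_pos.mpr ht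
    have e2 : ‖((t⁻¹ : ℝ) : ℂ) * (phase (t • φ) x - 1)‖ ≤ |φ x| := by
      rw [norm_mul, Complex.norm_real, norm_inv, Real.norm_eq_abs, inv_mul_le_iff₀ ht']
      exact e1
    have e3 : ‖(φ x : ℂ) * Complex.I‖ = |φ x| := by simp
    rw [hx, norm_mul, norm_mul, e3, ← mul_assoc]
    gcongr
    refine (norm_sub_le _ _).trans ?_
    rw [e3]
    linarith [abs_nonneg (φ x)]
  · refine Eventually.of_forall fun x => ?_
    have h1 : HasDerivAt (fun t : ℝ => phase (t • φ) x) (φ x * Complex.I) 0 := by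
      have h0 : HasDerivAt (fun t : ℝ => ((t : ℂ) * φ x) * Complex.I)
          ((1 * φ x) * Complex.I) 0 :=
        ((Complex.ofRealCLM.hasDerivAt (x := (0 : ℝ))).mul_const _).mul_const _
      have := h0.cexp
      simpa [phase_apply] using this
    rw [hasDerivAt_iff_tendsto_slope_zero] at h1
    have h2 := (h1.sub_const (φ x * Complex.I)).mul_const (u x)
    simpa [phase_apply, Complex.real_smul] using h2

/-- The reverse direction is dominated convergence. For the forward one, a cut-off `χ` that makes
`φχ` bounded commutes with the group, and uniqueness of the derivative on `χu` identifies `χv`. On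
the Fourier side this computes the exact generator both of translations and of the free Schrödinger
group. -/
theorem hasDerivAt_mulOp_phase_iff {d : ℕ} (φ : C(Rd d, ℝ)) {u v : L2Rd d} :
    HasDerivAt (fun t : ℝ => mulOp (phase (t • φ)) u) v 0 ↔
      ∀ᵐ x, v x = (φ x * Complex.I) * u x := by
  refine ⟨fun h => ?_, hasDerivAt_mulOp_phase_of_ae φ⟩
  -- `χ = 1/(1 + φ²)` never vanishes, so it can be cancelled at the end, and `χ' = φχ` is bounded,
  -- so `χu` lies in the domain of multiplication by `φ`.
  let χ : Rd d →ᵇ ℂ := BoundedContinuousFunction.ofNormedAddCommGroup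
    (fun x => ((1 + φ x ^ 2)⁻¹ : ℝ))
    (Complex.continuous_ofReal.comp (Continuous.inv₀ (by fun_prop) fun x => by positivity)) 1
    (fun x => by
      rw [Complex.norm_real, Real.norm_eq_abs, abs_of_nonneg (by positivity)]
      exact inv_le_one_of_one_le₀ (by nlinarith [sq_nonneg (φ x)]))
  let χ' : Rd d →ᵇ ℂ := BoundedContinuousFunction.ofNormedAddCommGroup
    (fun x => (φ x * (1 + φ x ^ 2)⁻¹ : ℝ))
    (Complex.continuous_ofReal.comp (φ.continuous.mul
      (Continuous.inv₀ (by fun_prop) fun x => by positivity))) 1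
    (fun x => by
      rw [Complex.norm_real, Real.norm_eq_abs, abs_mul, abs_of_nonneg (a := (_)⁻¹) (by positivity),
        ← div_eq_mul_inv, div_le_one (by positivity)]
      nlinarith [sq_nonneg (|φ x| - 1), sq_abs (φ x), abs_nonneg (φ x)])
  have h1 : HasDerivAt (fun t : ℝ => mulOp (phase (t • φ)) (mulOp χ u)) (mulOp χ v) 0 := by
    have := (mulOp χ).restrictScalars ℝ |>.hasFDerivAt.comp_hasDerivAt (0 : ℝ) h
    refine this.congr_of_eventuallyEq (Eventually.of_forall fun t => ?_)
    exact mulOp_comm _ _ _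
  have h2 : HasDerivAt (fun t : ℝ => mulOp (phase (t • φ)) (mulOp χ u))
      (mulOp (Complex.I • χ') u) 0 := by
    apply hasDerivAt_mulOp_phase_of_ae
    filter_upwards [coeFn_mulOp χ u, coeFn_mulOp (Complex.I • χ') u] with x e1 e2
    rw [e1, e2]
    change Complex.I * ((φ x * (1 + φ x ^ 2)⁻¹ : ℝ) : ℂ) * u x =
      φ x * Complex.I * (((1 + φ x ^ 2)⁻¹ : ℝ) * u x)
    push_cast
    ring
  have h3 := h1.unique h2
  filter_upwards [coeFn_mulOp χ v, coeFn_mulOp (Complex.I • χ') u] with x e1 e2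
  rw [h3, e2] at e1
  change Complex.I * ((φ x * (1 + φ x ^ 2)⁻¹ : ℝ) : ℂ) * u x =
      (((1 + φ x ^ 2)⁻¹ : ℝ) * v x) at e1
  have hne : (((1 + φ x ^ 2)⁻¹ : ℝ) : ℂ) ≠ 0 := by
    exact_mod_cast (by positivity : (1 + φ x ^ 2)⁻¹ ≠ 0)
  apply mul_left_cancel₀ hne
  rw [← e1]
  push_cast
  ring

/-! ### The Fourier transform and translations on `L²` -/

/-- The Fourier transform on `L²`. -/
noncomputable abbrev ft {d : ℕ} : L2Rd d ≃ₗᵢ[ℂ] L2Rd d := Lp.fourierTransformₗᵢ (Rd d) ℂ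

/-- Translation `u ↦ u(· + a)` on `L²`. -/
noncomputable def shiftL2 {d : ℕ} (a : Rd d) : L2Rd d →ₗᵢ[ℂ] L2Rd d :=
  Lp.compMeasurePreservingₗᵢ ℂ (fun x => x + a) (measurePreserving_add_right volume a)

theorem coeFn_shiftL2 {d : ℕ} (a : Rd d) (u : L2Rd d) :
    shiftL2 a u =ᵐ[volume] fun x => u (x + a) :=
  Lp.coeFn_compMeasurePreserving u (measurePreserving_add_right volume a)

/-- The function `ξ ↦ 2π⟨ξ, a⟩`. -/
noncomputable def linPhase {d : ℕ} (a : Rd d) : C(Rd d, ℝ) :=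
  ⟨fun ξ => 2 * Real.pi * inner ℝ ξ a, by fun_prop⟩

theorem ft_toLp {d : ℕ} (g : 𝓢(Rd d, ℂ)) :
    ft (g.toLp 2 : L2Rd d) = ((𝓕 g : 𝓢(Rd d, ℂ)).toLp 2 : L2Rd d) :=
  SchwartzMap.toLp_fourier_eq g

/-- Both sides are continuous in `u`, so the integral formula for Schwartz functions suffices. -/
theorem ft_shiftL2 {d : ℕ} (a : Rd d) (u : L2Rd d) :
    ft (shiftL2 a u) = mulOp (phase (linPhase a)) (ft u) := by
  refine DenseRange.induction_on
    (p := fun u : L2Rd d => ft (shiftL2 a u) = mulOp (phase (linPhase a)) (ft u))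
    (SchwartzMap.denseRange_toLpCLM (E := Rd d) (F := ℂ) (p := 2) (μ := volume)
      ENNReal.ofNat_ne_top) u ?_ ?_
  · exact isClosed_eq (ft.continuous.comp (shiftL2 a).continuous)
      ((mulOp _).continuous.comp ft.continuous)
  intro f
  have h1 : shiftL2 a (f.toLp 2 : L2Rd d) =
      ((SchwartzMap.compSubConstCLM ℂ (-a) f).toLp 2 : L2Rd d) := by
    apply Lp.ext
    have h := (measurePreserving_add_right (volume : Measure (Rd d)) a).quasiMeasurePreserving.ae
      (f.coeFn_toLp 2 (volume : Measure (Rd d)))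
    filter_upwards [coeFn_shiftL2 a (f.toLp 2 : L2Rd d), h,
      (SchwartzMap.compSubConstCLM ℂ (-a) f).coeFn_toLp 2 (volume : Measure (Rd d))]
      with x e1 e2 e3
    rw [e1, e2, e3]
    simp
  change ft (shiftL2 a (f.toLp 2 : L2Rd d)) = mulOp (phase (linPhase a)) (ft (f.toLp 2 : L2Rd d))
  rw [h1]
  rw [ft_toLp, ft_toLp]
  symm
  apply mulOp_eq_of_ae
  filter_upwards [(𝓕 f).coeFn_toLp 2 (volume : Measure (Rd d)),
    (𝓕 (SchwartzMap.compSubConstCLM ℂ (-a) f)).coeFn_toLp 2 (volume : Measure (Rd d))]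
    with ξ e1 e2
  rw [e1, e2]
  rw [SchwartzMap.fourier_coe, SchwartzMap.fourier_coe]
  have h2 := VectorFourier.fourierIntegral_comp_add_right Real.fourierChar
    (volume : Measure (Rd d)) (innerₗ (Rd d)) (f : Rd d → ℂ) a
  have h3 : (SchwartzMap.compSubConstCLM ℂ (-a) f : Rd d → ℂ) = f ∘ fun v => v + a := by
    ext v; simp
  rw [h3]
  have h4 := congrFun h2 ξ
  refine h4.trans ?_
  rw [Circle.smul_def, smul_eq_mul]
  congr 1
  rw [phase_apply, Real.fourierChar_apply]
  simp [linPhase, real_inner_comm]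

/-! ### Directional derivatives of `L²` functions -/

/-- `v ∈ L²` is the derivative of `u ∈ L²` in the direction `e`. -/
def HasD {d : ℕ} (e : Rd d) (u v : L2Rd d) : Prop :=
  ∀ᵐ ξ, ft v ξ = (linPhase e ξ * Complex.I) * ft u ξ

/-- The two descriptions serve different purposes: the Fourier one gives uniqueness, linearity and
integration by parts pointwise in `ξ`, while the translation one gives the product rule. -/
theorem hasD_iff_hasDerivAt {d : ℕ} {e : Rd d} {u v : L2Rd d} :
    HasD e u v ↔ HasDerivAt (fun t : ℝ => shiftL2 (t • e) u) v 0 := by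
  have hl : ∀ t : ℝ, linPhase (t • e) = t • linPhase e := by
    intro t; ext ξ; simp [linPhase, inner_smul_right]; ring
  have h1 : HasDerivAt (fun t : ℝ => shiftL2 (t • e) u) v 0 ↔
      HasDerivAt (fun t : ℝ => ft (shiftL2 (t • e) u)) (ft v) 0 := by
    constructor
    · intro h
      exact ((ft (d := d)).toContinuousLinearEquiv.toContinuousLinearMap.restrictScalars
        ℝ).hasFDerivAt.comp_hasDerivAt (0 : ℝ) h
    · intro h
      have := ((ft (d := d)).symm.toContinuousLinearEquiv.toContinuousLinearMap.restrictScalars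
        ℝ).hasFDerivAt.comp_hasDerivAt (0 : ℝ) h
      simpa [Function.comp_def] using this
  rw [h1]
  simp only [ft_shiftL2, hl]
  exact (hasDerivAt_mulOp_phase_iff (linPhase e)).symm

theorem HasD.unique {d : ℕ} {e : Rd d} {u v w : L2Rd d} (h1 : HasD e u v) (h2 : HasD e u w) :
    v = w := by
  apply ft.injective
  apply Lp.ext
  filter_upwards [h1, h2] with ξ a b
  rw [a, b]

theorem HasD.add {d : ℕ} {e : Rd d} {u v u' v' : L2Rd d} (h1 : HasD e u u') (h2 : HasD e v v') :
    HasD e (u + v) (u' + v') := by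
  unfold HasD
  rw [map_add, map_add]
  filter_upwards [h1, h2, Lp.coeFn_add (ft u) (ft v), Lp.coeFn_add (ft u') (ft v')] with ξ a b c e
  rw [c, e, Pi.add_apply, Pi.add_apply, a, b]
  ring

theorem HasD.smul {d : ℕ} {e : Rd d} {u u' : L2Rd d} (c : ℂ) (h1 : HasD e u u') :
    HasD e (c • u) (c • u') := by
  unfold HasD
  rw [map_smul, map_smul]
  filter_upwards [h1, Lp.coeFn_smul c (ft u), Lp.coeFn_smul c (ft u')] with ξ a b e
  rw [b, e, Pi.smul_apply, Pi.smul_apply, a, smul_eq_mul, smul_eq_mul]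
  ring

theorem HasD.inner_left {d : ℕ} {e : Rd d} {u v u' v' : L2Rd d} (h1 : HasD e u u')
    (h2 : HasD e v v') : inner ℂ u' v = -inner ℂ u v' := by
  rw [← ft.inner_map_map u' v, ← ft.inner_map_map u v', L2.inner_def, L2.inner_def,
    ← integral_neg]
  apply integral_congr_ae
  filter_upwards [h1, h2] with ξ a b
  rw [a, b]
  simp
  ring

/-- `g'` is the derivative of the function `g` in the direction `e`. -/
def HasDirDeriv {d : ℕ} (e : Rd d) (g g' : Rd d →ᵇ ℂ) : Prop :=
  ∀ x, HasDerivAt (fun t : ℝ => g (x + t • e)) (g' x) 0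

theorem HasDirDeriv.hasDerivAt {d : ℕ} {e : Rd d} {g g' : Rd d →ᵇ ℂ} (h : HasDirDeriv e g g')
    (x : Rd d) (s : ℝ) : HasDerivAt (fun t : ℝ => g (x + t • e)) (g' (x + s • e)) s := by
  have h1 := h (x + s • e)
  have h2 : HasDerivAt (fun t : ℝ => t - s) 1 s := (hasDerivAt_id s).sub_const s
  have h3 := HasDerivAt.scomp_of_eq s h1 h2 (sub_self s).symm
  simp only [one_smul] at h3
  refine h3.congr_of_eventuallyEq (Eventually.of_forall fun t => ?_)
  simp only [Function.comp]
  congr 1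
  module

theorem HasDirDeriv.norm_shift_sub_le {d : ℕ} {e : Rd d} {g g' : Rd d →ᵇ ℂ} (h : HasDirDeriv e g g')
    (x : Rd d) (t : ℝ) : ‖g (x + t • e) - g x‖ ≤ ‖g'‖ * |t| := by
  have := Convex.norm_image_sub_le_of_norm_hasDerivWithin_le (s := Set.univ)
    (f := fun t : ℝ => g (x + t • e)) (f' := fun s => g' (x + s • e)) (C := ‖g'‖) (x := 0) (y := t)
    (fun s _ => (h.hasDerivAt x s).hasDerivWithinAt) (fun s _ => g'.norm_coe_le_norm _)
    convex_univ trivial trivial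
  simpa using this

/-- The translate `g(· + a)` of a bounded continuous function. -/
noncomputable def shiftBCF {d : ℕ} (a : Rd d) (g : Rd d →ᵇ ℂ) : Rd d →ᵇ ℂ :=
  g.compContinuous ⟨fun x => x + a, by fun_prop⟩

theorem shiftBCF_apply {d : ℕ} (a : Rd d) (g : Rd d →ᵇ ℂ) (x : Rd d) :
    shiftBCF a g x = g (x + a) := rfl

theorem shiftL2_mulOp {d : ℕ} (a : Rd d) (g : Rd d →ᵇ ℂ) (u : L2Rd d) :
    shiftL2 a (mulOp g u) = mulOp (shiftBCF a g) (shiftL2 a u) := by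
  symm
  apply mulOp_eq_of_ae
  have h := (measurePreserving_add_right (volume : Measure (Rd d)) a).quasiMeasurePreserving.ae
    (coeFn_mulOp g u)
  filter_upwards [coeFn_shiftL2 a (mulOp g u), coeFn_shiftL2 a u, h] with x h1 h2 h3
  rw [h1, h2, h3, shiftBCF_apply]

theorem norm_shiftBCF_apply_le {d : ℕ} (a : Rd d) (g : Rd d →ᵇ ℂ) (x : Rd d) :
    ‖shiftBCF a g x‖ ≤ ‖g‖ := g.norm_coe_le_norm _

theorem tendsto_mulOp_shiftBCF_sub {d : ℕ} (e : Rd d) (g : Rd d →ᵇ ℂ) (v : L2Rd d) :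
    Tendsto (fun t : ℝ => mulOp (shiftBCF (t • e) g + (-1 : ℂ) • g) v) (𝓝[≠] 0) (𝓝 0) := by
  refine L2Rd.tendsto_zero_of_dominated (b := fun x => 2 * ‖g‖ * ‖v x‖)
    (G := fun t x => (g (x + t • e) - g x) * v x) ((Lp.memLp v).norm.const_mul _) ?_ ?_ ?_
  · intro t
    filter_upwards [coeFn_mulOp (shiftBCF (t • e) g + (-1 : ℂ) • g) v] with x hx
    rw [hx]
    simp [shiftBCF_apply, sub_eq_add_neg]
  · refine Eventually.of_forall fun t => Eventually.of_forall fun x => ?_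
    rw [norm_mul]
    gcongr
    refine (norm_sub_le _ _).trans ?_
    linarith [g.norm_coe_le_norm x, g.norm_coe_le_norm (x + t • e)]
  · refine Eventually.of_forall fun x => ?_
    have hc : Continuous fun t : ℝ => (g (x + t • e) - g x) * v x := by fun_prop
    have := hc.tendsto 0
    simp only [zero_smul, add_zero, sub_self, zero_mul] at this
    exact this.mono_left nhdsWithin_le_nhds

theorem HasDirDeriv.tendsto_mulOp_slope {d : ℕ} {e : Rd d} {g g' : Rd d →ᵇ ℂ}
    (hg : HasDirDeriv e g g') (u : L2Rd d) :
    Tendsto (fun t : ℝ => mulOp (((t⁻¹ : ℝ) : ℂ) • (shiftBCF (t • e) g +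
      (-1 : ℂ) • g) + (-1 : ℂ) • g') u) (𝓝[≠] 0) (𝓝 0) := by
  refine L2Rd.tendsto_zero_of_dominated (b := fun x => 2 * ‖g'‖ * ‖u x‖)
    (G := fun t x => (t⁻¹ • (g (x + t • e) - g x) - g' x) * u x)
    ((Lp.memLp u).norm.const_mul _) ?_ ?_ ?_
  · intro t
    filter_upwards [coeFn_mulOp (((t⁻¹ : ℝ) : ℂ) • (shiftBCF (t • e) g +
      (-1 : ℂ) • g) + (-1 : ℂ) • g') u] with x hx
    rw [hx]
    simp [shiftBCF_apply, sub_eq_add_neg]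
  · filter_upwards [self_mem_nhdsWithin] with t ht
    refine Eventually.of_forall fun x => ?_
    rw [norm_mul]
    gcongr
    refine (norm_sub_le _ _).trans ?_
    have ht' : 0 < |t| := abs_pos.mpr ht
    have h1 : ‖t⁻¹ • (g (x + t • e) - g x)‖ ≤ ‖g'‖ := by
      rw [norm_smul, norm_inv, Real.norm_eq_abs, inv_mul_le_iff₀ ht', mul_comm]
      exact hg.norm_shift_sub_le x t
    linarith [g'.norm_coe_le_norm x]
  · refine Eventually.of_forall fun x => ?_
    have h1 := hg x
    rw [hasDerivAt_iff_tendsto_slope_zero] at h1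
    simpa using (h1.sub_const (g' x)).mul_const (u x)

theorem shiftL2_zero_smul {d : ℕ} (e : Rd d) (w : L2Rd d) : shiftL2 ((0 : ℝ) • e) w = w := by
  apply Lp.ext
  filter_upwards [coeFn_shiftL2 ((0 : ℝ) • e) w] with x hx
  rw [hx]; simp

/-- The product rule for a bounded `C¹` function with bounded derivative. -/
theorem HasD.boundedContinuous_mul {d : ℕ} {e : Rd d} {u v : L2Rd d} (h : HasD e u v)
    {g g' : Rd d →ᵇ ℂ} (hg : HasDirDeriv e g g') :
    HasD e (mulOp g u) (mulOp g' u + mulOp g v) := by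
  rw [hasD_iff_hasDerivAt, hasDerivAt_iff_tendsto_slope_zero] at *
  simp only [zero_add, shiftL2_zero_smul] at *
  have p1 : Tendsto (fun t : ℝ => mulOp (shiftBCF (t • e) g)
      (t⁻¹ • (shiftL2 (t • e) u - u) - v)) (𝓝[≠] 0) (𝓝 0) := by
    rw [← tendsto_sub_nhds_zero_iff] at h
    refine squeeze_zero_norm
      (fun t => norm_mulOp_le (norm_shiftBCF_apply_le (t • e) g)
        (t⁻¹ • (shiftL2 (t • e) u - u) - v)) ?_
    simpa using h.norm.const_mul ‖g‖
  -- The difference quotient of `gu` minus its limit splits into `g(· + te)` times the error in the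
  -- quotient of `u`, `(g(· + te) - g) v`, and the error in the quotient of `g` times `u`. Each
  -- tends to zero in `L²`.
  have p4 := ((p1.add (tendsto_mulOp_shiftBCF_sub e g v)).add
    (hg.tendsto_mulOp_slope u)).add_const (mulOp g' u + mulOp g v)
  simp only [add_zero, zero_add] at p4
  refine p4.congr fun t => ?_
  have : ∀ w : L2Rd d, ((t⁻¹ : ℝ) : ℂ) • w = t⁻¹ • w := fun w => Complex.coe_smul _ _
  have h2 : mulOp (shiftBCF (t • e) g) (t⁻¹ • (shiftL2 (t • e) u - u)) =
      t⁻¹ • (mulOp (shiftBCF (t • e) g) (shiftL2 (t • e) u) - mulOp (shiftBCF (t • e) g) u) := by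
    rw [← this, map_smul, map_sub, this]
  rw [shiftL2_mulOp, map_sub, h2]
  simp only [mulOp_add, mulOp_smul, this]
  module

/-! ### Sobolev spaces and the Laplacian on the Fourier side -/

theorem fourier_coe_eq {d : ℕ} (u : L2Rd d) :
    (𝓕 (u : 𝓢'(Rd d, ℂ)) : 𝓢'(Rd d, ℂ)) = (ft u : L2Rd d) :=
  Lp.fourier_toTemperedDistribution_eq u

theorem fourierInv_coe_eq {d : ℕ} (u : L2Rd d) :
    (𝓕⁻ (u : 𝓢'(Rd d, ℂ)) : 𝓢'(Rd d, ℂ)) = (ft.symm u : L2Rd d) :=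
  Lp.fourierInv_toTemperedDistribution_eq u

theorem smulLeftCLM_coe_eq_of_ae {d : ℕ} {g : Rd d → ℂ} (hg : g.HasTemperateGrowth)
    {u f : L2Rd d} (h : ∀ᵐ x, f x = g x * u x) :
    TemperedDistribution.smulLeftCLM ℂ g (u : 𝓢'(Rd d, ℂ)) = (f : 𝓢'(Rd d, ℂ)) := by
  ext φ
  simp only [TemperedDistribution.smulLeftCLM_apply_apply, Lp.toTemperedDistribution_apply]
  apply integral_congr_ae
  filter_upwards [h] with x hx
  rw [hx, SchwartzMap.smulLeftCLM_apply_apply hg]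
  simp only [smul_eq_mul]
  ring

theorem hasTemperateGrowth_bessel {d : ℕ} (r : ℝ) :
    (fun x : Rd d => (((1 + ‖x‖ ^ 2) ^ r : ℝ) : ℂ)).HasTemperateGrowth := by
  fun_prop

theorem inSobolev_iff {d : ℕ} {s : ℝ} (hs : 0 ≤ s) {ψ : L2Rd d} :
    InSobolev s ψ ↔
      ∃ f : L2Rd d, ∀ᵐ ξ, f ξ = (((1 + ‖ξ‖ ^ 2) ^ (s / 2) : ℝ) : ℂ) * ft ψ ξ := by
  unfold InSobolev
  rw [TemperedDistribution.memSobolev_iff_exists_smulLeftCLM_fourier, fourier_coe_eq]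
  constructor
  · rintro ⟨f, hf⟩
    refine ⟨f, ?_⟩
    -- The inverse weight is bounded because `s ≥ 0`. Multiplying by it recovers `ft ψ` from `f` in
    -- `L²`, which turns an identity of distributions into one almost everywhere.
    let χ : Rd d →ᵇ ℂ := BoundedContinuousFunction.ofNormedAddCommGroup
      (fun x => (((1 + ‖x‖ ^ 2) ^ (-(s / 2)) : ℝ) : ℂ))
      (hasTemperateGrowth_bessel (-(s / 2))).1.continuous 1 (fun x => by
        rw [Complex.norm_real, Real.norm_eq_abs, abs_of_nonneg (by positivity)]
        exact Real.rpow_le_one_of_one_le_of_nonpos (by nlinarith [sq_nonneg ‖x‖]) (by linarith))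
    have h1 : ft ψ = mulOp χ f := by
      apply L2Rd.ext_distribution
      rw [← smulLeftCLM_coe_eq_of_ae (hasTemperateGrowth_bessel (-(s / 2))) (coeFn_mulOp χ f),
        ← hf, TemperedDistribution.smulLeftCLM_smulLeftCLM_apply (hasTemperateGrowth_bessel _)
          (hasTemperateGrowth_bessel _)]
      have h2 : ((fun x : Rd d => (((1 + ‖x‖ ^ 2) ^ (s / 2) : ℝ) : ℂ)) *
          fun x : Rd d => (((1 + ‖x‖ ^ 2) ^ (-(s / 2)) : ℝ) : ℂ)) = fun _ => 1 := by
        ext x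
        rw [Pi.mul_apply, ← Complex.ofReal_mul, ← Real.rpow_add (by positivity)]
        simp
      rw [h2, TemperedDistribution.smulLeftCLM_const, one_smul]
    filter_upwards [coeFn_mulOp χ f] with ξ h2
    rw [h1, h2]
    change _ = _ * ((((1 + ‖ξ‖ ^ 2) ^ (-(s / 2)) : ℝ) : ℂ) * _)
    rw [← mul_assoc, ← Complex.ofReal_mul, ← Real.rpow_add (by positivity)]
    simp
  · rintro ⟨f, hf⟩
    exact ⟨f, smulLeftCLM_coe_eq_of_ae (hasTemperateGrowth_bessel _) hf⟩

theorem inSobolev_two_iff {d : ℕ} {ψ : L2Rd d} :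
    InSobolev 2 ψ ↔ ∃ f : L2Rd d, ∀ᵐ ξ, f ξ = ((‖ξ‖ ^ 2 : ℝ) : ℂ) * ft ψ ξ := by
  rw [inSobolev_iff (by norm_num)]
  have e : ∀ ξ : Rd d, (((1 + ‖ξ‖ ^ 2) ^ ((2 : ℝ) / 2) : ℝ) : ℂ) = 1 + ((‖ξ‖ ^ 2 : ℝ) : ℂ) := by
    intro ξ; simp
  constructor
  · rintro ⟨f, hf⟩
    refine ⟨f - ft ψ, ?_⟩
    filter_upwards [hf, Lp.coeFn_sub f (ft ψ)] with ξ h1 h2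
    rw [h2, Pi.sub_apply, h1, e]
    ring
  · rintro ⟨f, hf⟩
    refine ⟨ft ψ + f, ?_⟩
    filter_upwards [hf, Lp.coeFn_add (ft ψ) f] with ξ h1 h2
    rw [h2, Pi.add_apply, h1, e]
    ring

/-- The symbol `4π²|ξ|²` of `-Δ`. -/
noncomputable def lapSymbol {d : ℕ} : C(Rd d, ℝ) :=
  ⟨fun ξ => (2 * Real.pi) ^ 2 * ‖ξ‖ ^ 2, by fun_prop⟩

theorem ft_laplacianL2 {d : ℕ} {ψ : L2Rd d} (h : InSobolev 2 ψ) :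
    ∀ᵐ ξ, ft (laplacianL2 ψ h) ξ = -((lapSymbol ξ : ℝ) : ℂ) * ft ψ ξ := by
  obtain ⟨f, hf⟩ := inSobolev_two_iff.mp h
  have key : laplacianL2 ψ h = ((-(2 * Real.pi) ^ 2 : ℝ) : ℂ) • ft.symm f := by
    apply L2Rd.ext_distribution
    rw [← laplacianL2_spec, TemperedDistribution.laplacian_eq_fourierMultiplierCLM,
      TemperedDistribution.fourierMultiplierCLM_apply, fourier_coe_eq,
      smulLeftCLM_coe_eq_of_ae (by fun_prop) hf, fourierInv_coe_eq, ← Complex.coe_smul]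
    exact (map_smul (Lp.toTemperedDistributionCLM ℂ (volume : Measure (Rd d)) 2) _ _).symm
  have h2 : ft (laplacianL2 ψ h) = ((-(2 * Real.pi) ^ 2 : ℝ) : ℂ) • f := by
    rw [key, map_smul, LinearIsometryEquiv.apply_symm_apply]
  rw [h2]
  filter_upwards [hf, Lp.coeFn_smul ((-(2 * Real.pi) ^ 2 : ℝ) : ℂ) f] with ξ h3 h4
  rw [h4, Pi.smul_apply, h3, smul_eq_mul]
  simp [lapSymbol]
  ring

theorem inSobolev_two_iff_lapSymbol {d : ℕ} {ψ : L2Rd d} :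
    InSobolev 2 ψ ↔ ∃ f : L2Rd d, ∀ᵐ ξ, f ξ = ((lapSymbol ξ : ℝ) : ℂ) * ft ψ ξ := by
  rw [inSobolev_two_iff]
  have hpi : (2 * (Real.pi : ℂ)) ^ 2 ≠ 0 := by
    simp [Real.pi_ne_zero]
  constructor
  · rintro ⟨f, hf⟩
    refine ⟨(2 * (Real.pi : ℂ)) ^ 2 • f, ?_⟩
    filter_upwards [hf, Lp.coeFn_smul ((2 * (Real.pi : ℂ)) ^ 2) f] with ξ h1 h2
    rw [h2, Pi.smul_apply, h1, smul_eq_mul]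
    simp [lapSymbol]
    ring
  · rintro ⟨f, hf⟩
    refine ⟨((2 * (Real.pi : ℂ)) ^ 2)⁻¹ • f, ?_⟩
    filter_upwards [hf, Lp.coeFn_smul ((2 * (Real.pi : ℂ)) ^ 2)⁻¹ f] with ξ h1 h2
    rw [h2, Pi.smul_apply, h1, smul_eq_mul]
    simp only [lapSymbol, ContinuousMap.coe_mk]
    push_cast
    field_simp

/-! ### Bounded perturbations of unitary groups -/

section Dyson

variable {𝓗 : Type*} [NormedAddCommGroup 𝓗] [InnerProductSpace ℂ 𝓗]

theorem continuous_apply_of_strongly_continuous {L : ℝ → 𝓗 →L[ℂ] 𝓗} {K : ℝ}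
    (hL : ∀ x, Continuous fun t => L t x) (hK : ∀ t x, ‖L t x‖ ≤ K * ‖x‖) {a : ℝ → 𝓗}
    (ha : Continuous a) : Continuous fun t => L t (a t) := by
  rw [continuous_iff_continuousAt]
  intro s
  have h1 : Tendsto (fun t => L t (a t - a s)) (𝓝 s) (𝓝 0) := by
    refine squeeze_zero_norm (fun t => hK t (a t - a s)) ?_
    have := (ha.tendsto s).sub_const (a s)
    simpa using this.norm.const_mul K
  have h2 := h1.add ((hL (a s)).tendsto s)
  simp only [zero_add, ← map_add, sub_add_cancel] at h2
  exact h2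

/-- Integrating the power gains the factor `1/(n + 1)` at each step, which builds the factorial in
the Dyson series. Negative times follow by reflection. -/
theorem norm_integral_le_of_norm_le_pow [CompleteSpace 𝓗] {f : ℝ → 𝓗} {C : ℝ} {n : ℕ}
    (hf : ∀ s, ‖f s‖ ≤ C * |s| ^ n) (t : ℝ) :
    ‖∫ s in (0 : ℝ)..t, f s‖ ≤ C * |t| ^ (n + 1) / (n + 1) := by
  have pos : ∀ (g : ℝ → 𝓗), (∀ s, ‖g s‖ ≤ C * |s| ^ n) → ∀ t : ℝ, 0 ≤ t →
      ‖∫ s in (0 : ℝ)..t, g s‖ ≤ C * |t| ^ (n + 1) / (n + 1) := by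
    intro g hg t ht
    have h1 := intervalIntegral.norm_integral_le_of_norm_le (μ := volume) (f := g)
      (g := fun s => C * s ^ n) ht
      (Eventually.of_forall fun s hs => by simpa [abs_of_pos hs.1] using hg s)
      (by apply Continuous.intervalIntegrable; fun_prop)
    refine h1.trans (le_of_eq ?_)
    rw [intervalIntegral.integral_const_mul, integral_pow, abs_of_nonneg ht]
    simp
    ring
  rcases le_total 0 t with ht | ht
  · exact pos f hf t ht
  · have h1 := pos (fun s => f (-s)) (fun s => by simpa using hf (-s)) (-t) (by linarith)
    rw [intervalIntegral.integral_comp_neg, neg_zero, neg_neg, intervalIntegral.integral_symm,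
      norm_neg, abs_neg] at h1
    exact h1

/-- The terms of the Dyson series. -/
noncomputable def dysonTerm (L : ℝ → 𝓗 →L[ℂ] 𝓗) (x : 𝓗) : ℕ → ℝ → 𝓗
  | 0 => fun _ => x
  | n + 1 => fun t => ∫ s in (0 : ℝ)..t, L s (dysonTerm L x n s)

theorem continuous_dysonTerm {L : ℝ → 𝓗 →L[ℂ] 𝓗} {K : ℝ}
    (hL : ∀ x, Continuous fun t => L t x) (hK : ∀ t x, ‖L t x‖ ≤ K * ‖x‖) (x : 𝓗) (n : ℕ) :
    Continuous (dysonTerm L x n) := by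
  induction n with
  | zero => exact continuous_const
  | succ n ih =>
    have h := continuous_apply_of_strongly_continuous hL hK ih
    exact intervalIntegral.continuous_primitive (fun a b => h.intervalIntegrable a b) 0

theorem norm_dysonTerm_le [CompleteSpace 𝓗] {L : ℝ → 𝓗 →L[ℂ] 𝓗} {K : ℝ} (hK0 : 0 ≤ K)
    (hK : ∀ t x, ‖L t x‖ ≤ K * ‖x‖) (x : 𝓗) (n : ℕ) (t : ℝ) :
    ‖dysonTerm L x n t‖ ≤ ‖x‖ * K ^ n / n.factorial * |t| ^ n := by
  induction n generalizing t with
  | zero => simp [dysonTerm]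
  | succ n ih =>
    have h := norm_integral_le_of_norm_le_pow (f := fun s => L s (dysonTerm L x n s))
      (C := K * (‖x‖ * K ^ n / n.factorial)) (n := n) (fun s => by
        refine (hK s _).trans ?_
        rw [mul_assoc]
        exact mul_le_mul_of_nonneg_left (ih s) hK0) t
    refine h.trans (le_of_eq ?_)
    rw [Nat.factorial_succ]
    push_cast
    have : (n.factorial : ℝ) ≠ 0 := by positivity
    field_simp
    ring

/-- Global solvability of a linear equation with bounded strongly continuous coefficients. -/
theorem exists_solution_linear [CompleteSpace 𝓗] {L : ℝ → 𝓗 →L[ℂ] 𝓗} {K : ℝ} (hK0 : 0 ≤ K)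
    (hL : ∀ x, Continuous fun t => L t x) (hK : ∀ t x, ‖L t x‖ ≤ K * ‖x‖) (x : 𝓗) :
    ∃ w : ℝ → 𝓗, w 0 = x ∧ ∀ t, HasDerivAt w (L t (w t)) t := by
  set a := dysonTerm L x with ha
  have hsum : ∀ t, Summable fun n => a n t := by
    intro t
    refine Summable.of_norm_bounded ((Real.summable_pow_div_factorial (K * |t|)).mul_left ‖x‖) ?_
    intro n
    refine (norm_dysonTerm_le hK0 hK x n t).trans (le_of_eq ?_)
    rw [mul_pow]; ring
  have ha' : ∀ n t, HasDerivAt (a (n + 1)) (L t (a n t)) t := by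
    intro n t
    have hc := continuous_apply_of_strongly_continuous hL hK (continuous_dysonTerm hL hK x n)
    exact intervalIntegral.integral_hasDerivAt_right (hc.intervalIntegrable _ _)
      (hc.stronglyMeasurableAtFilter _ _) hc.continuousAt
  refine ⟨fun t => x + ∑' n, a (n + 1) t, ?_, ?_⟩
  · have : ∀ n, a (n + 1) 0 = 0 := fun n => intervalIntegral.integral_same
    simp [this]
  · intro t
    have h1 : HasDerivAt (fun t => ∑' n, a (n + 1) t) (∑' n, L t (a n t)) t := by
      refine hasDerivAt_tsum_of_isPreconnected (t := Metric.ball 0 (|t| + 1)) (y₀ := t)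
        (g := fun n => a (n + 1)) (g' := fun n s => L s (a n s))
        (u := fun n => K * (‖x‖ * ((K * (|t| + 1)) ^ n / n.factorial)))
        (((Real.summable_pow_div_factorial _).mul_left _).mul_left _) Metric.isOpen_ball
        (convex_ball _ _).isPreconnected (fun n y _ => ha' n y) ?_ ?_ ?_ ?_
      · intro n y hy
        refine (hK y _).trans (mul_le_mul_of_nonneg_left ?_ hK0)
        refine (norm_dysonTerm_le hK0 hK x n y).trans ?_
        have hy' : |y| ≤ |t| + 1 := by
          rw [mem_ball_zero_iff, Real.norm_eq_abs] at hy
          exact hy.le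
        calc ‖x‖ * K ^ n / n.factorial * |y| ^ n
            ≤ ‖x‖ * K ^ n / n.factorial * (|t| + 1) ^ n := by gcongr
          _ = _ := by rw [mul_pow]; ring
      · simp
      · exact (summable_nat_add_iff 1).mpr (hsum t)
      · simp
    have h2 := h1.const_add x
    have h3 : L t (x + ∑' n, a (n + 1) t) = ∑' n, L t (a n t) := by
      rw [← ContinuousLinearMap.map_tsum _ (hsum t), (hsum t).tsum_eq_zero_add]
      rfl
    rw [h3]
    exact h2

theorem hasDerivAt_norm_sq_of_complex {w : ℝ → 𝓗} {w' : 𝓗} {t : ℝ} (hw : HasDerivAt w w' t) :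
    HasDerivAt (fun s => ‖w s‖ ^ 2) (2 * (inner ℂ (w t) w').re) t := by
  have h3 := Complex.reCLM.hasFDerivAt.comp_hasDerivAt t (hw.inner ℂ hw)
  have e : Complex.reCLM (inner ℂ (w t) w' + inner ℂ w' (w t)) = 2 * (inner ℂ (w t) w').re := by
    have e0 : (inner ℂ w' (w t)).re = (inner ℂ (w t) w').re := by
      rw [← inner_conj_symm, Complex.conj_re]
    simp only [Complex.reCLM_apply, Complex.add_re, e0]
    ring
  rw [e] at h3
  refine h3.congr_of_eventuallyEq (Eventually.of_forall fun s => ?_)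
  simp [inner_self_eq_norm_sq_to_K, ← Complex.ofReal_pow]

/-- Applied to a solution, this gives isometry; applied to the difference of two solutions, it gives
uniqueness. -/
theorem norm_eq_of_hasDerivAt_skew {w : ℝ → 𝓗} {w' : ℝ → 𝓗} (hw : ∀ t, HasDerivAt w (w' t) t)
    (hskew : ∀ t, (inner ℂ (w t) (w' t)).re = 0) (t : ℝ) : ‖w t‖ = ‖w 0‖ := by
  have h1 : ∀ t, HasDerivAt (fun s => ‖w s‖ ^ 2) 0 t := fun t => by
    simpa [hskew] using hasDerivAt_norm_sq_of_complex (hw t)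
  have h4 := is_const_of_deriv_eq_zero (fun t => (h1 t).differentiableAt)
    (fun t => (h1 t).deriv) t 0
  exact (sq_eq_sq₀ (norm_nonneg _) (norm_nonneg _)).mp h4

/-- Since `w 0 = 0`, the difference quotient is `W t` applied to `t⁻¹ w t`, so strong continuity of
`W` is enough and no vector has to lie in the domain of a generator. -/
theorem hasDerivAt_zero_of_isometry {W : ℝ → 𝓗 →ₗᵢ[ℂ] 𝓗} {w : ℝ → 𝓗} {w' : 𝓗}
    (hW : ∀ x, Tendsto (fun t => W t x) (𝓝 0) (𝓝 x)) (hw : HasDerivAt w w' 0) (h0 : w 0 = 0) :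
    HasDerivAt (fun t => W t (w t)) w' 0 := by
  rw [hasDerivAt_iff_tendsto_slope_zero] at *
  simp only [zero_add, h0, sub_zero, map_zero] at *
  have h1 : Tendsto (fun t => W t (t⁻¹ • w t - w')) (𝓝[≠] 0) (𝓝 0) := by
    rw [← tendsto_sub_nhds_zero_iff] at hw
    refine squeeze_zero_norm (fun t => (W t).norm_map _ |>.le) ?_
    simpa using hw.norm
  have h2 := h1.add ((hW w').mono_left nhdsWithin_le_nhds)
  simp only [zero_add, map_sub, sub_add_cancel] at h2
  refine h2.congr fun t => ?_
  rw [← Complex.coe_smul, map_smul, Complex.coe_smul]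

/-- Interaction picture: `U t = U₀ t ∘ w t`, where `w' = -i U₀(-t) B U₀(t) w`. These coefficients
are bounded, strongly continuous and skew-adjoint, so `w` exists globally and preserves the norm
even though `A₀` is unbounded. -/
theorem exists_isUnitaryGroupOf_of_bounded_perturbation [CompleteSpace 𝓗] {A₀ A : 𝓗 →ₗ.[ℂ] 𝓗}
    {U₀ : ℝ → (𝓗 ≃ₗᵢ[ℂ] 𝓗)} (h₀ : IsUnitaryGroupOf A₀ U₀) (B : 𝓗 →L[ℂ] 𝓗)
    (hB : ∀ x y, inner ℂ (B x) y = inner ℂ x (B y))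
    (hA : ∀ ψ φ, (ψ, φ) ∈ A.graph ↔ (ψ, φ - B ψ) ∈ A₀.graph) :
    ∃ U, IsUnitaryGroupOf A U := by
  have hU0inv : ∀ t ψ, U₀ (-t) (U₀ t ψ) = ψ := fun t ψ => by
    rw [← h₀.map_add, neg_add_cancel, h₀.map_zero]
  have hU0inv' : ∀ t ψ, U₀ t (U₀ (-t) ψ) = ψ := fun t ψ => by
    rw [← h₀.map_add, add_neg_cancel, h₀.map_zero]
  let u₀ : ℝ → 𝓗 →L[ℂ] 𝓗 := fun t => (U₀ t).toContinuousLinearEquiv.toContinuousLinearMap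
  have hu₀ : ∀ t x, ‖u₀ t x‖ ≤ 1 * ‖x‖ := fun t x => by
    rw [one_mul]; exact ((U₀ t).norm_map x).le
  let L : ℝ → 𝓗 →L[ℂ] 𝓗 := fun t => (-Complex.I) • (u₀ (-t)).comp (B.comp (u₀ t))
  have hLapp : ∀ t x, L t x = -(Complex.I • U₀ (-t) (B (U₀ t x))) := fun t x => by
    change (-Complex.I) • U₀ (-t) (B (U₀ t x)) = _
    rw [neg_smul]
  have hLc : ∀ x, Continuous fun t => L t x := by
    intro x
    simp only [hLapp]
    have h1 : Continuous fun t => u₀ (-t) (B (U₀ t x)) :=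
      continuous_apply_of_strongly_continuous (L := fun t => u₀ (-t)) (K := 1)
        (fun y => (h₀.continuous y).comp continuous_neg) (fun t y => hu₀ (-t) y)
        (B.continuous.comp (h₀.continuous x))
    exact (h1.const_smul Complex.I).neg
  have hLK : ∀ t x, ‖L t x‖ ≤ ‖B‖ * ‖x‖ := by
    intro t x
    rw [hLapp, norm_neg, norm_smul, Complex.norm_I, one_mul, (U₀ (-t)).norm_map]
    simpa [(U₀ t).norm_map] using B.le_opNorm (U₀ t x)
  have hskew : ∀ t x, (inner ℂ x (L t x)).re = 0 := by
    intro t x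
    rw [hLapp, inner_neg_right, inner_smul_right]
    have h1 : inner ℂ x (U₀ (-t) (B (U₀ t x))) = inner ℂ (U₀ t x) (B (U₀ t x)) := by
      rw [← (U₀ t).inner_map_map x, hU0inv']
    have h2 : (inner ℂ (U₀ t x) (B (U₀ t x))).im = 0 := by
      rw [← Complex.conj_eq_iff_im, inner_conj_symm, hB]
    rw [h1]
    simp [h2]
  choose w hw0 hw using exists_solution_linear (norm_nonneg B) hLc hLK
  have hnorm : ∀ x t, ‖w x t‖ = ‖x‖ := fun x t => by
    rw [norm_eq_of_hasDerivAt_skew (hw x) (fun t => hskew t _) t, hw0]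
  have huniq : ∀ (v : ℝ → 𝓗), (∀ t, HasDerivAt v (L t (v t)) t) → ∀ t, v t = w (v 0) t := by
    intro v hv t
    have h1 := norm_eq_of_hasDerivAt_skew (w := fun t => v t - w (v 0) t)
      (w' := fun t => L t (v t - w (v 0) t))
      (fun t => by rw [map_sub]; exact (hv t).sub (hw _ t)) (fun t => hskew t _) t
    simp only [hw0, sub_self, norm_zero, norm_eq_zero] at h1
    exact sub_eq_zero.mp h1
  have hadd : ∀ x y t, w (x + y) t = w x t + w y t := by
    intro x y t
    have := huniq (fun t => w x t + w y t)
      (fun t => by rw [map_add]; exact (hw x t).add (hw y t)) t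
    simpa [hw0] using this.symm
  have hsmul : ∀ (c : ℂ) x t, w (c • x) t = c • w x t := by
    intro c x t
    have := huniq (fun t => c • w x t)
      (fun t => by rw [map_smul]; exact (hw x t).const_smul c) t
    simpa [hw0] using this.symm
  let u : ℝ → 𝓗 →ₗᵢ[ℂ] 𝓗 := fun t =>
    { toFun := fun x => U₀ t (w x t)
      map_add' := fun x y => by rw [hadd, map_add]
      map_smul' := fun c x => by rw [hsmul, map_smul, RingHom.id_apply]
      norm_map' := fun x => by
        change ‖U₀ t (w x t)‖ = _
        rw [(U₀ t).norm_map, hnorm] }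
  have huapp : ∀ t x, u t x = U₀ t (w x t) := fun _ _ => rfl
  have hu0 : ∀ x, u 0 x = x := fun x => by rw [huapp, h₀.map_zero, hw0]
  have hgroup : ∀ s t x, u (s + t) x = u s (u t x) := by
    intro s t x
    -- The shifted solution, transported by `U₀ t`, solves the same equation with initial value `u t
    -- x`; uniqueness then gives the group law.
    have h1 := huniq (fun s => U₀ t (w x (s + t))) (fun s => by
      have h2 := (hw x (s + t)).comp_add_const s t
      have h3 := (u₀ t).restrictScalars ℝ |>.hasFDerivAt.comp_hasDerivAt s h2
      have h4 : (u₀ t) (L (s + t) (w x (s + t))) = L s (U₀ t (w x (s + t))) := by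
        change U₀ t (L (s + t) (w x (s + t))) = _
        rw [hLapp, hLapp, map_neg, map_smul, ← h₀.map_add, ← h₀.map_add]
        congr 4
        ring
      rw [← h4]
      exact h3) s
    simp only [zero_add] at h1
    rw [huapp s, huapp t, ← h1, ← h₀.map_add, huapp]
  have hsurj : ∀ t x, u t (u (-t) x) = x := fun t x => by
    rw [← hgroup, add_neg_cancel, hu0]
  let U : ℝ → (𝓗 ≃ₗᵢ[ℂ] 𝓗) := fun t =>
    LinearIsometryEquiv.ofSurjective (u t) (fun x => ⟨u (-t) x, hsurj t x⟩)
  have hUapp : ∀ t x, U t x = U₀ t (w x t) := fun _ _ => rfl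
  refine ⟨U, hu0, hgroup, ?_, ?_⟩
  · intro ψ
    exact continuous_apply_of_strongly_continuous (L := u₀) (K := 1) h₀.continuous hu₀
      (continuous_iff_continuousAt.mpr fun t => (hw ψ t).continuousAt)
  · intro ψ φ
    have h1 : HasDerivAt (fun t => w ψ t - ψ) (-(Complex.I • B ψ)) 0 := by
      have := (hw ψ 0).sub_const ψ
      rw [hLapp, hw0, h₀.map_zero, neg_zero, h₀.map_zero] at this
      exact this
    -- For every `ψ`, `U t ψ` and `U₀ t ψ` differ by a path that is differentiable at `0`. So the
    -- two groups have generators with the same domain, which is what makes the generator exact.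
    have h2 : HasDerivAt (fun t => U₀ t (w ψ t - ψ)) (-(Complex.I • B ψ)) 0 :=
      hasDerivAt_zero_of_isometry (W := fun t => (U₀ t).toLinearIsometry)
        (fun x => by
          have := (h₀.continuous x).tendsto 0
          rwa [h₀.map_zero] at this) h1 (by rw [hw0, sub_self])
    rw [hA, ← h₀.generator]
    constructor
    · intro h
      have := h.sub h2
      convert! this using 1
      · ext t; simp [hUapp]
      · rw [smul_sub]; abel
    · intro h
      have := h.add h2
      convert! this using 1
      · ext t; simp [hUapp]
      · rw [smul_sub]; abel

end Dyson

/-! ### Consequences of being a unitary group -/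

section UnitaryGroup

variable {𝓗 : Type*} [NormedAddCommGroup 𝓗] [InnerProductSpace ℂ 𝓗] {A : 𝓗 →ₗ.[ℂ] 𝓗}
  {U : ℝ → (𝓗 ≃ₗᵢ[ℂ] 𝓗)}

theorem IsUnitaryGroupOf.hasDerivAt_of_mem_graph (h : IsUnitaryGroupOf A U) {ψ φ : 𝓗}
    (hψ : (ψ, φ) ∈ A.graph) (t : ℝ) :
    HasDerivAt (fun s => U s ψ) (U t (-(Complex.I • φ))) t := by
  have h1 := (h.generator ψ φ).mpr hψ
  have h2 := HasDerivAt.comp_sub_const t t (f := fun s => U s ψ) (by rw [sub_self]; exact h1)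
  have h3 := ((U t).toContinuousLinearEquiv.toContinuousLinearMap.restrictScalars
    ℝ).hasFDerivAt.comp_hasDerivAt t h2
  refine h3.congr_of_eventuallyEq (Eventually.of_forall fun s => ?_)
  change U s ψ = U t (U (s - t) ψ)
  rw [← h.map_add, add_sub_cancel]

theorem IsUnitaryGroupOf.mem_graph_map (h : IsUnitaryGroupOf A U) {ψ φ : 𝓗}
    (hψ : (ψ, φ) ∈ A.graph) (t : ℝ) : (U t ψ, U t φ) ∈ A.graph := by
  rw [← h.generator]
  have h1 := h.hasDerivAt_of_mem_graph hψ t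
  have h2 := HasDerivAt.comp_add_const 0 t (f := fun s => U s ψ) (by rw [zero_add]; exact h1)
  rw [map_neg, map_smul] at h2
  refine h2.congr_of_eventuallyEq (Eventually.of_forall fun s => ?_)
  exact (h.map_add _ _ _).symm

theorem mem_powDomain_succ_iff {k : ℕ} {ψ : 𝓗} :
    ψ ∈ powDomain A (k + 1) ↔ ∃ φ, (ψ, φ) ∈ A.graph ∧ φ ∈ powDomain A k := by
  constructor
  · rintro ⟨h, h'⟩
    exact ⟨_, A.mem_graph ⟨ψ, h⟩, h'⟩
  · rintro ⟨φ, h1, h2⟩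
    obtain ⟨y, rfl, rfl⟩ := (LinearPMap.mem_graph_iff A).mp h1
    exact ⟨y.2, h2⟩

theorem powApply_succ {k : ℕ} {ψ φ : 𝓗} (h : (ψ, φ) ∈ A.graph) (hψ : ψ ∈ powDomain A (k + 1))
    (hφ : φ ∈ powDomain A k) : powApply A (k + 1) ψ hψ = powApply A k φ hφ := by
  obtain ⟨y, rfl, rfl⟩ := (LinearPMap.mem_graph_iff A).mp h
  rfl

theorem IsUnitaryGroupOf.map_mem_powDomain (h : IsUnitaryGroupOf A U) {k : ℕ} {ψ : 𝓗}
    (hψ : ψ ∈ powDomain A k) (t : ℝ) : U t ψ ∈ powDomain A k := by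
  induction k generalizing ψ with
  | zero => trivial
  | succ k ih =>
    obtain ⟨φ, h1, h2⟩ := mem_powDomain_succ_iff.mp hψ
    exact mem_powDomain_succ_iff.mpr ⟨_, h.mem_graph_map h1 t, ih h2⟩

theorem IsUnitaryGroupOf.norm_powApply_map (h : IsUnitaryGroupOf A U) {k : ℕ} {ψ : 𝓗}
    (hψ : ψ ∈ powDomain A k) (t : ℝ) (hψ' : U t ψ ∈ powDomain A k) :
    ‖powApply A k (U t ψ) hψ'‖ = ‖powApply A k ψ hψ‖ := by
  induction k generalizing ψ with
  | zero => exact (U t).norm_map ψ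
  | succ k ih =>
    obtain ⟨φ, h1, h2⟩ := mem_powDomain_succ_iff.mp hψ
    rw [powApply_succ h1 hψ h2,
      powApply_succ (h.mem_graph_map h1 t) hψ' (h.map_mem_powDomain h2 t)]
    exact ih h2 _

theorem powDomain_succ_subset {k : ℕ} {ψ : 𝓗} (hψ : ψ ∈ powDomain A (k + 1)) :
    ψ ∈ powDomain A k := by
  induction k generalizing ψ with
  | zero => trivial
  | succ k ih =>
    obtain ⟨φ, h1, h2⟩ := mem_powDomain_succ_iff.mp hψ
    exact mem_powDomain_succ_iff.mpr ⟨φ, h1, ih h2⟩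

theorem powDomain_anti {j k : ℕ} (hjk : j ≤ k) {ψ : 𝓗} (hψ : ψ ∈ powDomain A k) :
    ψ ∈ powDomain A j := by
  induction hjk with
  | refl => exact hψ
  | step _ ih => exact ih (powDomain_succ_subset hψ)

theorem sumNormPow_nonneg (m : ℕ) (ψ : 𝓗) : 0 ≤ sumNormPow A m ψ := by
  refine Finset.sum_nonneg fun k _ => ?_
  split_ifs
  · exact norm_nonneg _
  · exact le_rfl

theorem sumNormPow_mono {j m : ℕ} (hjm : j ≤ m) (ψ : 𝓗) :
    sumNormPow A j ψ ≤ sumNormPow A m ψ := by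
  refine Finset.sum_le_sum_of_subset_of_nonneg
    (Finset.range_mono (Nat.succ_le_succ hjm)) fun k _ _ => ?_
  split_ifs
  · exact norm_nonneg _
  · exact le_rfl

theorem sumNormPow_succ {k : ℕ} {ψ φ : 𝓗} (h : (ψ, φ) ∈ A.graph) (hφ : φ ∈ powDomain A k) :
    sumNormPow A (k + 1) ψ = ‖ψ‖ + sumNormPow A k φ := by
  have hψ := mem_powDomain_succ_iff.mpr ⟨φ, h, hφ⟩
  unfold sumNormPow
  rw [Finset.sum_range_succ', add_comm]
  congr 1
  · have h0 : ψ ∈ powDomain A 0 := trivial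
    rw [dif_pos h0]
    rfl
  · refine Finset.sum_congr rfl fun j hj => ?_
    have hj' : j ≤ k := Nat.lt_succ_iff.mp (Finset.mem_range.mp hj)
    have h1 := powDomain_anti hj' hφ
    have h2 := powDomain_anti (Nat.succ_le_succ hj') hψ
    rw [dif_pos h1, dif_pos h2, powApply_succ h h2 h1]

/-- The group commutes with `A`, so every `‖A^j ψ‖` is conserved. This is the source of regularity
bounds that do not grow in time. -/
theorem IsUnitaryGroupOf.sumNormPow_map (h : IsUnitaryGroupOf A U) {k : ℕ} {ψ : 𝓗}
    (hψ : ψ ∈ powDomain A k) (t : ℝ) : sumNormPow A k (U t ψ) = sumNormPow A k ψ := by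
  unfold sumNormPow
  refine Finset.sum_congr rfl fun j hj => ?_
  have h1 := powDomain_anti (Nat.lt_succ_iff.mp (Finset.mem_range.mp hj)) hψ
  have h2 := h.map_mem_powDomain h1 t
  rw [dif_pos h1, dif_pos h2, h.norm_powApply_map h1 t h2]

end UnitaryGroup

/-! ### The Schrödinger group -/

/-- For bounded `V` the condition `Vψ ∈ L²` is automatic, so the graph is that of the multiplier
`4π²|ξ|²` sheared by a bounded operator. This form feeds both the perturbation argument and elliptic
regularity. -/
theorem mem_graph_schrodingerOp_iff {d : ℕ} {V : Rd d → ℝ} {W : Rd d →ᵇ ℂ}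
    (hW : ∀ x, W x = V x) {ψ φ : L2Rd d} :
    (ψ, φ) ∈ (schrodingerOp V).graph ↔
      ∀ᵐ ξ, ft (φ - mulOp W ψ) ξ = ((lapSymbol ξ : ℝ) : ℂ) * ft ψ ξ := by
  have key : ∀ (h : InSobolev 2 ψ ∧ MulMemL2 V ψ),
      schrodingerOp V ⟨ψ, h⟩ = -laplacianL2 ψ h.1 + mulOp W ψ := by
    intro h
    change -laplacianL2 ψ h.1 + MemLp.toLp (fun x => (V x : ℂ) * ψ x) h.2 = _
    congr 1
    symm
    apply mulOp_eq_of_ae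
    filter_upwards [h.2.coeFn_toLp] with x hx
    rw [hx, hW]
  have hlap : ∀ h : InSobolev 2 ψ,
      ∀ᵐ ξ, ft (-laplacianL2 ψ h) ξ = ((lapSymbol ξ : ℝ) : ℂ) * ft ψ ξ := by
    intro h
    rw [map_neg]
    filter_upwards [ft_laplacianL2 h, Lp.coeFn_neg (ft (laplacianL2 ψ h))] with ξ h1 h2
    rw [h2, Pi.neg_apply, h1]
    ring
  rw [LinearPMap.mem_graph_iff]
  constructor
  · rintro ⟨⟨χ, h⟩, h1, rfl⟩
    obtain rfl : χ = ψ := h1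
    rw [key h, add_sub_cancel_right]
    exact hlap h.1
  · intro h
    have h1 : InSobolev 2 ψ := inSobolev_two_iff_lapSymbol.mpr ⟨_, h⟩
    have h2 : MulMemL2 V ψ := by
      have := memLp_boundedContinuous_mul W ψ
      simp only [hW] at this
      exact this
    refine ⟨⟨ψ, h1, h2⟩, rfl, ?_⟩
    rw [key ⟨h1, h2⟩, ← eq_sub_iff_add_eq]
    apply ft.injective
    apply Lp.ext
    filter_upwards [h, hlap h1] with ξ a b
    rw [a, b]

theorem continuous_mulOp_phase {d : ℕ} (φ : C(Rd d, ℝ)) (u : L2Rd d) :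
    Continuous fun t : ℝ => mulOp (phase (t • φ)) u := by
  rw [continuous_iff_continuousAt]
  intro s
  have h1 : Tendsto (fun t : ℝ => t - s) (𝓝 s) (𝓝 0) := by
    have : Continuous fun t : ℝ => t - s := by fun_prop
    simpa using this.tendsto s
  have h2 := (tendsto_mulOp_phase φ (mulOp (phase (s • φ)) u)).comp h1
  refine h2.congr fun t => ?_
  simp only [Function.comp]
  rw [← mulOp_mul, ← phase_add, ← add_smul, sub_add_cancel]

theorem exists_isUnitaryGroupOf_free (d : ℕ) :
    ∃ U, IsUnitaryGroupOf (schrodingerOp (fun _ : Rd d => (0 : ℝ))) U := by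
  let φ : C(Rd d, ℝ) := -lapSymbol
  let u : ℝ → L2Rd d →ₗᵢ[ℂ] L2Rd d := fun t =>
    { toFun := fun ψ => ft.symm (mulOp (phase (t • φ)) (ft ψ))
      map_add' := fun x y => by simp only [map_add]
      map_smul' := fun c x => by simp only [map_smul, RingHom.id_apply]
      norm_map' := fun x => by
        change ‖ft.symm (mulOp (phase (t • φ)) (ft x))‖ = _
        rw [LinearIsometryEquiv.norm_map, norm_mulOp_phase, LinearIsometryEquiv.norm_map] }
  have huapp : ∀ t ψ, u t ψ = ft.symm (mulOp (phase (t • φ)) (ft ψ)) := fun _ _ => rfl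
  have hu0 : ∀ ψ, u 0 ψ = ψ := fun ψ => by
    rw [huapp, zero_smul, phase_zero, mulOp_one, LinearIsometryEquiv.symm_apply_apply]
  have hadd : ∀ s t ψ, u (s + t) ψ = u s (u t ψ) := fun s t ψ => by
    rw [huapp, huapp, huapp, LinearIsometryEquiv.apply_symm_apply, add_smul, phase_add, mulOp_mul]
  refine ⟨fun t => LinearIsometryEquiv.ofSurjective (u t)
    (fun x => ⟨u (-t) x, by rw [← hadd, add_neg_cancel, hu0]⟩), hu0, hadd, ?_, ?_⟩
  · intro ψ
    exact ft.symm.continuous.comp (continuous_mulOp_phase φ (ft ψ))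
  · intro ψ χ
    rw [mem_graph_schrodingerOp_iff (W := 0) (fun x => by simp)]
    have h0 : mulOp (0 : Rd d →ᵇ ℂ) ψ = 0 := by
      apply mulOp_eq_of_ae
      filter_upwards [Lp.coeFn_zero ℂ 2 (volume : Measure (Rd d))] with x hx
      rw [hx]; simp
    rw [h0, sub_zero]
    have h1 : HasDerivAt (fun t : ℝ => u t ψ) (-(Complex.I • χ)) 0 ↔
        HasDerivAt (fun t : ℝ => mulOp (phase (t • φ)) (ft ψ)) (ft (-(Complex.I • χ))) 0 := by
      constructor
      · intro h
        have := ((ft (d := d)).toContinuousLinearEquiv.toContinuousLinearMap.restrictScalars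
          ℝ).hasFDerivAt.comp_hasDerivAt (0 : ℝ) h
        simpa [Function.comp_def, huapp] using this
      · intro h
        have := ((ft (d := d)).symm.toContinuousLinearEquiv.toContinuousLinearMap.restrictScalars
          ℝ).hasFDerivAt.comp_hasDerivAt (0 : ℝ) h
        simpa [Function.comp_def, huapp] using this
    refine h1.trans ((hasDerivAt_mulOp_phase_iff φ).trans ?_)
    rw [← neg_smul, map_smul]
    refine eventually_congr ?_
    filter_upwards [Lp.coeFn_smul (-Complex.I) (ft χ)] with ξ h2
    rw [h2, Pi.smul_apply, smul_eq_mul]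
    have e : ((φ ξ : ℝ) : ℂ) * Complex.I * ft ψ ξ = -Complex.I * ((lapSymbol ξ : ℝ) * ft ψ ξ) := by
      simp [φ]; ring
    rw [e]
    exact mul_right_inj' (neg_ne_zero.mpr Complex.I_ne_zero)

theorem isUnitaryGroupOf_schrodingerOp {d : ℕ} {V : Rd d → ℝ} {W : Rd d →ᵇ ℂ}
    (hW : ∀ x, W x = V x) :
    IsUnitaryGroupOf (schrodingerOp V) (unitaryGroup (schrodingerOp V)) := by
  have hex : ∃ U, IsUnitaryGroupOf (schrodingerOp V) U := by
    obtain ⟨U₀, h₀⟩ := exists_isUnitaryGroupOf_free d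
    refine exists_isUnitaryGroupOf_of_bounded_perturbation h₀ (mulOp W) ?_ ?_
    · intro x y
      rw [inner_mulOp_left]
      congr 3
      ext x
      simp [hW]
    · intro ψ φ
      rw [mem_graph_schrodingerOp_iff hW, mem_graph_schrodingerOp_iff (W := 0) (fun x => by simp)]
      have h0 : mulOp (0 : Rd d →ᵇ ℂ) ψ = 0 := by
        apply mulOp_eq_of_ae
        filter_upwards [Lp.coeFn_zero ℂ 2 (volume : Measure (Rd d))] with x hx
        rw [hx]; simp
      rw [h0, sub_zero]
  unfold unitaryGroup
  rw [dif_pos hex]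
  exact hex.choose_spec

/-! ### Quantitative Sobolev regularity -/

/-- The `j`-th standard basis vector of `ℝ^d`. -/
noncomputable abbrev stdVec {d : ℕ} (j : Fin d) : Rd d := EuclideanSpace.single j 1

/-- All mixed partial derivatives of `u` of order at most `s` are in `L²` with norm at most `K`. -/
def SobolevBound {d : ℕ} : ℕ → L2Rd d → ℝ → Prop
  | 0, u, K => ‖u‖ ≤ K
  | s + 1, u, K => ‖u‖ ≤ K ∧ ∀ j, ∃ v, HasD (stdVec j) u v ∧ SobolevBound s v K

namespace SobolevBound

variable {d : ℕ}

theorem norm_le {s : ℕ} {u : L2Rd d} {K : ℝ} (h : SobolevBound s u K) : ‖u‖ ≤ K := by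
  cases s with
  | zero => exact h
  | succ s => exact h.1

theorem mono {s : ℕ} {u : L2Rd d} {K K' : ℝ} (h : SobolevBound s u K) (hK : K ≤ K') :
    SobolevBound s u K' := by
  induction s generalizing u with
  | zero => exact le_trans h hK
  | succ s ih =>
    refine ⟨h.1.trans hK, fun j => ?_⟩
    obtain ⟨v, h1, h2⟩ := h.2 j
    exact ⟨v, h1, ih h2⟩

theorem of_succ {s : ℕ} {u : L2Rd d} {K : ℝ} (h : SobolevBound (s + 1) u K) :
    SobolevBound s u K := by
  induction s generalizing u with
  | zero => exact h.1
  | succ s ih =>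
    refine ⟨h.1, fun j => ?_⟩
    obtain ⟨v, h1, h2⟩ := h.2 j
    exact ⟨v, h1, ih h2⟩

theorem anti {s s' : ℕ} (hs : s ≤ s') {u : L2Rd d} {K : ℝ} (h : SobolevBound s' u K) :
    SobolevBound s u K := by
  induction hs with
  | refl => exact h
  | step _ ih => exact ih h.of_succ

theorem add {s : ℕ} {u v : L2Rd d} {K K' : ℝ} (h : SobolevBound s u K)
    (h' : SobolevBound s v K') : SobolevBound s (u + v) (K + K') := by
  induction s generalizing u v with
  | zero => exact (norm_add_le _ _).trans (add_le_add h h')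
  | succ s ih =>
    refine ⟨(norm_add_le _ _).trans (add_le_add h.1 h'.1), fun j => ?_⟩
    obtain ⟨a, h1, h2⟩ := h.2 j
    obtain ⟨b, h3, h4⟩ := h'.2 j
    exact ⟨a + b, h1.add h3, ih h2 h4⟩

theorem smul {s : ℕ} {u : L2Rd d} {K : ℝ} (c : ℂ) (h : SobolevBound s u K) :
    SobolevBound s (c • u) (‖c‖ * K) := by
  induction s generalizing u with
  | zero =>
    change ‖c • u‖ ≤ _
    rw [norm_smul]
    exact mul_le_mul_of_nonneg_left h (norm_nonneg c)
  | succ s ih =>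
    refine ⟨?_, fun j => ?_⟩
    · rw [norm_smul]
      exact mul_le_mul_of_nonneg_left h.1 (norm_nonneg c)
    · obtain ⟨a, h1, h2⟩ := h.2 j
      exact ⟨c • a, h1.smul c, ih h2⟩

theorem neg {s : ℕ} {u : L2Rd d} {K : ℝ} (h : SobolevBound s u K) : SobolevBound s (-u) K := by
  simpa using h.smul (-1)

end SobolevBound

/-- The bounded continuous function `g` is of class `C^s` with bounded derivatives. -/
def SmoothBound {d : ℕ} : ℕ → (Rd d →ᵇ ℂ) → Prop
  | 0, _ => True
  | s + 1, g => ∀ j, ∃ g', HasDirDeriv (stdVec j) g g' ∧ SmoothBound s g'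

theorem SmoothBound.anti {d : ℕ} {s s' : ℕ} (hs : s ≤ s') {g : Rd d →ᵇ ℂ}
    (h : SmoothBound s' g) : SmoothBound s g := by
  induction s' generalizing s g with
  | zero => obtain rfl : s = 0 := by omega
            trivial
  | succ n ih =>
    cases s with
    | zero => trivial
    | succ s =>
      intro j
      obtain ⟨g', h1, h2⟩ := h j
      exact ⟨g', h1, ih (by omega) h2⟩

/-- Induction on `s` by the product rule; the constant depends on `g` and `s` only. -/
theorem SmoothBound.exists_mulOp_bound {d : ℕ} {s : ℕ} {g : Rd d →ᵇ ℂ} (hg : SmoothBound s g) :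
    ∃ c : ℝ, 0 ≤ c ∧ ∀ u K, SobolevBound s u K → SobolevBound s (mulOp g u) (c * K) := by
  induction s generalizing g with
  | zero =>
    exact ⟨‖g‖, norm_nonneg _, fun u K h => (norm_mulOp_le (fun x => g.norm_coe_le_norm x) u).trans
      (mul_le_mul_of_nonneg_left h (norm_nonneg _))⟩
  | succ s ih =>
    obtain ⟨c, hc0, hc⟩ := ih (hg.anti (Nat.le_succ s))
    choose g' h1 h2 using hg
    choose c' hc0' hc' using fun j => ih (h2 j)
    have hsum : 0 ≤ ∑ j, c' j := Finset.sum_nonneg fun j _ => hc0' j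
    refine ⟨‖g‖ + c + ∑ j, c' j, by positivity, fun u K h => ⟨?_, fun j => ?_⟩⟩
    · have hK : 0 ≤ K := (norm_nonneg _).trans h.norm_le
      refine (norm_mulOp_le (fun x => g.norm_coe_le_norm x) u).trans ?_
      have : ‖g‖ * ‖u‖ ≤ ‖g‖ * K := mul_le_mul_of_nonneg_left h.norm_le (norm_nonneg _)
      nlinarith [mul_nonneg hc0 hK, mul_nonneg hsum hK]
    · have hK : 0 ≤ K := (norm_nonneg _).trans h.norm_le
      obtain ⟨v, hv, hv'⟩ := h.2 j
      refine ⟨_, hv.boundedContinuous_mul (h1 j),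
        ((hc' j u K h.of_succ).add (hc v K hv')).mono ?_⟩
      have hle : c' j ≤ ∑ j, c' j :=
        Finset.single_le_sum (fun j _ => hc0' j) (Finset.mem_univ j)
      nlinarith [mul_le_mul_of_nonneg_right hle hK, mul_nonneg (norm_nonneg g) hK]

theorem smoothBound_of_contDiff {d : ℕ} {n : ℕ} {f : Rd d → ℂ} (hf : ContDiff ℝ n f)
    (hb : ∀ k ≤ n, ∃ B : ℝ, ∀ x, ‖iteratedFDeriv ℝ k f x‖ ≤ B) {g : Rd d →ᵇ ℂ}
    (hg : ∀ x, g x = f x) : SmoothBound n g := by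
  induction n generalizing f g with
  | zero => trivial
  | succ n ih =>
    intro j
    let F : Rd d → ℂ := fun x => fderiv ℝ f x (stdVec j)
    have hF : ContDiff ℝ n F := by
      have : ContDiff ℝ n (fderiv ℝ f) := hf.fderiv_right (by norm_cast)
      exact this.clm_apply contDiff_const
    have hFb : ∀ k ≤ n, ∃ B : ℝ, ∀ x, ‖iteratedFDeriv ℝ k F x‖ ≤ B := by
      intro k hk
      obtain ⟨B, hB⟩ := hb (k + 1) (by omega)
      refine ⟨‖stdVec j‖ * B, fun x => ?_⟩
      have h1 : ContDiff ℝ n (fderiv ℝ f) := hf.fderiv_right (by norm_cast)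
      refine (norm_iteratedFDeriv_clm_apply_const (n := k) h1.contDiffAt
        (by exact_mod_cast hk)).trans ?_
      rw [norm_iteratedFDeriv_fderiv]
      exact mul_le_mul_of_nonneg_left (hB x) (norm_nonneg _)
    obtain ⟨B, hB⟩ := hFb 0 (Nat.zero_le _)
    simp only [norm_iteratedFDeriv_zero] at hB
    refine ⟨BoundedContinuousFunction.ofNormedAddCommGroup F hF.continuous B hB, ?_,
      ih hF hFb fun x => rfl⟩
    intro x
    have hd : HasFDerivAt f (fderiv ℝ f x) x :=
      (hf.differentiable (by norm_cast)).differentiableAt.hasFDerivAt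
    have h1 := hd.hasLineDerivAt (stdVec j)
    simp only [hg]
    exact h1

/-- The Fourier multiplier with symbol `g`. -/
noncomputable def fourierMul {d : ℕ} (g : Rd d →ᵇ ℂ) (u : L2Rd d) : L2Rd d :=
  ft.symm (mulOp g (ft u))

theorem ft_fourierMul {d : ℕ} (g : Rd d →ᵇ ℂ) (u : L2Rd d) :
    ft (fourierMul g u) = mulOp g (ft u) := ft.apply_symm_apply _

theorem norm_fourierMul_le {d : ℕ} {g : Rd d →ᵇ ℂ} {c : ℝ} (hc : ∀ x, ‖g x‖ ≤ c) (u : L2Rd d) :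
    ‖fourierMul g u‖ ≤ c * ‖u‖ := by
  unfold fourierMul
  rw [LinearIsometryEquiv.norm_map]
  simpa using norm_mulOp_le hc (ft u)

theorem HasD.map_fourierMul {d : ℕ} {e : Rd d} {u v : L2Rd d} (h : HasD e u v) (g : Rd d →ᵇ ℂ) :
    HasD e (fourierMul g u) (fourierMul g v) := by
  unfold HasD
  rw [ft_fourierMul, ft_fourierMul]
  filter_upwards [h, coeFn_mulOp g (ft u), coeFn_mulOp g (ft v)] with ξ h1 h2 h3
  rw [h2, h3, h1]
  ring

theorem SobolevBound.map_fourierMul {d : ℕ} {s : ℕ} {u : L2Rd d} {K : ℝ} (h : SobolevBound s u K)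
    {g : Rd d →ᵇ ℂ} (hg : ∀ x, ‖g x‖ ≤ 1) : SobolevBound s (fourierMul g u) K := by
  induction s generalizing u with
  | zero => exact (norm_fourierMul_le hg u).trans (by rw [one_mul]; exact h)
  | succ s ih =>
    refine ⟨(norm_fourierMul_le hg u).trans (by rw [one_mul]; exact h.1), fun j => ?_⟩
    obtain ⟨v, h1, h2⟩ := h.2 j
    exact ⟨_, h1.map_fourierMul g, ih h2⟩

theorem lapSymbol_nonneg {d : ℕ} (ξ : Rd d) : 0 ≤ lapSymbol ξ := by
  change 0 ≤ (2 * Real.pi) ^ 2 * ‖ξ‖ ^ 2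
  positivity

theorem lapSymbol_eq_sum {d : ℕ} (ξ : Rd d) :
    lapSymbol ξ = ∑ j, linPhase (stdVec j) ξ ^ 2 := by
  change (2 * Real.pi) ^ 2 * ‖ξ‖ ^ 2 = ∑ j, (2 * Real.pi * inner ℝ ξ (stdVec j)) ^ 2
  rw [EuclideanSpace.real_norm_sq_eq, Finset.mul_sum]
  refine Finset.sum_congr rfl fun j _ => ?_
  have : inner ℝ ξ (stdVec j) = ξ j := by
    rw [EuclideanSpace.inner_single_right]
    simp
  rw [this]
  ring

/-- The symbol `p / (1 + 4π²|ξ|²)`. -/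
noncomputable def resolventSymbol {d : ℕ} (p : C(Rd d, ℂ)) (hp : ∀ ξ, ‖p ξ‖ ≤ 1 + lapSymbol ξ) :
    Rd d →ᵇ ℂ :=
  BoundedContinuousFunction.ofNormedAddCommGroup (fun ξ => p ξ / ((1 + lapSymbol ξ : ℝ) : ℂ))
    (p.continuous.div (by fun_prop) fun ξ => by
      have := lapSymbol_nonneg ξ
      exact_mod_cast (by positivity : 1 + lapSymbol ξ ≠ 0)) 1
    (fun ξ => by
      have := lapSymbol_nonneg ξ
      rw [norm_div, Complex.norm_real, Real.norm_eq_abs, abs_of_nonneg (by positivity),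
        div_le_one (by positivity)]
      exact hp ξ)

theorem norm_resolventSymbol_le {d : ℕ} (p : C(Rd d, ℂ)) (hp : ∀ ξ, ‖p ξ‖ ≤ 1 + lapSymbol ξ)
    (ξ : Rd d) : ‖resolventSymbol p hp ξ‖ ≤ 1 := by
  have := lapSymbol_nonneg ξ
  change ‖p ξ / ((1 + lapSymbol ξ : ℝ) : ℂ)‖ ≤ 1
  rw [norm_div, Complex.norm_real, Real.norm_eq_abs, abs_of_nonneg (by positivity),
    div_le_one (by positivity)]
  exact hp ξ

theorem ft_fourierMul_resolventSymbol {d : ℕ} {u g : L2Rd d}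
    (h : ∀ᵐ ξ, ft g ξ = ((1 + lapSymbol ξ : ℝ) : ℂ) * ft u ξ) (p : C(Rd d, ℂ))
    (hp : ∀ ξ, ‖p ξ‖ ≤ 1 + lapSymbol ξ) :
    ∀ᵐ ξ, ft (fourierMul (resolventSymbol p hp) g) ξ = p ξ * ft u ξ := by
  rw [ft_fourierMul]
  filter_upwards [h, coeFn_mulOp (resolventSymbol p hp) (ft g)] with ξ h1 h2
  rw [h2, h1]
  change p ξ / ((1 + lapSymbol ξ : ℝ) : ℂ) * (((1 + lapSymbol ξ : ℝ) : ℂ) * ft u ξ) = _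
  have h3 : ((1 + lapSymbol ξ : ℝ) : ℂ) ≠ 0 := by
    have := lapSymbol_nonneg ξ
    exact_mod_cast (by positivity : 1 + lapSymbol ξ ≠ 0)
  field_simp

theorem abs_linPhase_stdVec_le {d : ℕ} (j : Fin d) (ξ : Rd d) :
    |linPhase (stdVec j) ξ| ≤ 2 * Real.pi * ‖ξ‖ := by
  change |2 * Real.pi * inner ℝ ξ (stdVec j)| ≤ _
  rw [abs_mul, abs_of_nonneg (by positivity)]
  gcongr
  simpa using abs_real_inner_le_norm ξ (stdVec j)

/-- Elliptic regularity for `1 - Δ`. -/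
theorem SobolevBound.of_one_sub_laplacian {d : ℕ} {s : ℕ} {u g : L2Rd d} {K : ℝ}
    (h : ∀ᵐ ξ, ft g ξ = ((1 + lapSymbol ξ : ℝ) : ℂ) * ft u ξ) (hg : SobolevBound s g K) :
    SobolevBound (s + 2) u K := by
  have hlap : ∀ ξ : Rd d, lapSymbol ξ = (2 * Real.pi * ‖ξ‖) ^ 2 := fun ξ => by
    change (2 * Real.pi) ^ 2 * ‖ξ‖ ^ 2 = _
    ring
  let q : Fin d → C(Rd d, ℂ) := fun j => ⟨fun ξ => linPhase (stdVec j) ξ * Complex.I, by fun_prop⟩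
  have hqn : ∀ j ξ, ‖q j ξ‖ ≤ 2 * Real.pi * ‖ξ‖ := by
    intro j ξ
    change ‖(linPhase (stdVec j) ξ : ℂ) * Complex.I‖ ≤ _
    simpa using abs_linPhase_stdVec_le j ξ
  have hq0 : ∀ ξ : Rd d, ‖(1 : C(Rd d, ℂ)) ξ‖ ≤ 1 + lapSymbol ξ := fun ξ => by
    simpa using lapSymbol_nonneg ξ
  have hq1 : ∀ j ξ, ‖q j ξ‖ ≤ 1 + lapSymbol ξ := by
    intro j ξ
    refine (hqn j ξ).trans ?_
    rw [hlap]
    nlinarith [sq_nonneg (2 * Real.pi * ‖ξ‖ - 1), sq_nonneg (2 * Real.pi * ‖ξ‖)]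
  have hq2 : ∀ i j ξ, ‖(q i * q j) ξ‖ ≤ 1 + lapSymbol ξ := by
    intro i j ξ
    rw [ContinuousMap.mul_apply, norm_mul, hlap]
    have := mul_le_mul (hqn i ξ) (hqn j ξ) (norm_nonneg _) (by positivity)
    nlinarith
  -- `u`, `∂_j u` and `∂_i ∂_j u` are images of `g` under multipliers `p / (1 + 4π²|ξ|²)` bounded by
  -- `1`. These commute with derivatives, so the bound `K` is kept and two orders are gained.
  have e0 : u = fourierMul (resolventSymbol 1 hq0) g := by
    apply ft.injective
    apply Lp.ext
    filter_upwards [ft_fourierMul_resolventSymbol h 1 hq0] with ξ h1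
    rw [h1]; simp
  have hu : ‖u‖ ≤ K := by
    rw [e0]
    exact (hg.map_fourierMul (norm_resolventSymbol_le 1 hq0)).norm_le
  refine ⟨hu, fun j => ⟨fourierMul (resolventSymbol (q j) (hq1 j)) g, ?_, ?_, fun i =>
    ⟨fourierMul (resolventSymbol (q i * q j) (hq2 i j)) g, ?_, ?_⟩⟩⟩
  · exact ft_fourierMul_resolventSymbol h (q j) (hq1 j)
  · exact (hg.map_fourierMul (norm_resolventSymbol_le _ _)).norm_le
  · filter_upwards [ft_fourierMul_resolventSymbol h (q j) (hq1 j),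
      ft_fourierMul_resolventSymbol h (q i * q j) (hq2 i j)] with ξ h1 h2
    rw [h1, h2, ContinuousMap.mul_apply, mul_assoc]
    rfl
  · exact hg.map_fourierMul (norm_resolventSymbol_le _ _)

theorem InSobolev.exists_sobolevBound {d : ℕ} {k : ℕ} {u : L2Rd d} (h : InSobolev (2 * k : ℝ) u) :
    ∃ K, SobolevBound (2 * k) u K := by
  rw [inSobolev_iff (by positivity)] at h
  have h' : ∃ f : L2Rd d, ∀ᵐ ξ, f ξ = (((1 + ‖ξ‖ ^ 2) ^ k : ℝ) : ℂ) * ft u ξ := by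
    obtain ⟨f, hf⟩ := h
    refine ⟨f, ?_⟩
    filter_upwards [hf] with ξ h1
    rw [h1]
    congr 2
    rw [mul_div_cancel_left₀ _ (by norm_num : (2 : ℝ) ≠ 0), Real.rpow_natCast]
  clear h
  -- `ρ` compares the symbol `1 + 4π²|ξ|²` of `1 - Δ` with the weight `1 + |ξ|²` of the Sobolev
  -- scale, and `τ` inverts that weight.
  let ρ : Rd d →ᵇ ℂ := BoundedContinuousFunction.ofNormedAddCommGroup
    (fun ξ => (((1 + lapSymbol ξ) / (1 + ‖ξ‖ ^ 2) : ℝ) : ℂ))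
    (Complex.continuous_ofReal.comp
      (Continuous.div (by fun_prop) (by fun_prop) fun ξ => by positivity))
    (1 + (2 * Real.pi) ^ 2) (fun ξ => by
      have := lapSymbol_nonneg ξ
      rw [Complex.norm_real, Real.norm_eq_abs, abs_of_nonneg (by positivity),
        div_le_iff₀ (by positivity)]
      change 1 + (2 * Real.pi) ^ 2 * ‖ξ‖ ^ 2 ≤ _
      nlinarith [sq_nonneg (2 * Real.pi), sq_nonneg ‖ξ‖])
  let τ : Rd d →ᵇ ℂ := BoundedContinuousFunction.ofNormedAddCommGroup
    (fun ξ => (((1 + ‖ξ‖ ^ 2)⁻¹ : ℝ) : ℂ))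
    (Complex.continuous_ofReal.comp
      (Continuous.inv₀ (by fun_prop) fun ξ => by positivity)) 1 (fun ξ => by
      rw [Complex.norm_real, Real.norm_eq_abs, abs_of_nonneg (by positivity)]
      exact inv_le_one_of_one_le₀ (by nlinarith [sq_nonneg ‖ξ‖]))
  have hρ : ∀ ξ, ρ ξ = (((1 + lapSymbol ξ) / (1 + ‖ξ‖ ^ 2) : ℝ) : ℂ) := fun _ => rfl
  have hτ : ∀ ξ, τ ξ = (((1 + ‖ξ‖ ^ 2)⁻¹ : ℝ) : ℂ) := fun _ => rfl
  induction k generalizing u with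
  | zero => exact ⟨‖u‖, le_rfl⟩
  | succ k ih =>
    obtain ⟨f, hf⟩ := h'
    -- Here `g = (1 - Δ)u`, which has two orders of regularity fewer; the witness `ρ f` passed to
    -- the induction is `(1 + |ξ|²)^k` times its Fourier transform.
    set g := ft.symm (mulOp (ρ * τ ^ k) f) with hg
    have h1 : ft g = mulOp (ρ * τ ^ k) f := ft.apply_symm_apply _
    have h2 : ∀ᵐ ξ, ft g ξ = ((1 + lapSymbol ξ : ℝ) : ℂ) * ft u ξ := by
      rw [h1]
      filter_upwards [hf, coeFn_mulOp (ρ * τ ^ k) f] with ξ a b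
      rw [b, a, BoundedContinuousFunction.mul_apply, BoundedContinuousFunction.pow_apply, hρ, hτ,
        ← mul_assoc]
      congr 1
      norm_cast
      have : (1 + ‖ξ‖ ^ 2) ≠ 0 := by positivity
      rw [inv_pow, pow_succ]
      field_simp
      ring
    obtain ⟨K, hK⟩ := ih (u := g) ⟨mulOp ρ f, by
      filter_upwards [hf, h2, coeFn_mulOp ρ f] with ξ a b c
      rw [c, a, b, hρ, ← mul_assoc, ← mul_assoc]
      congr 1
      norm_cast
      have : (1 + ‖ξ‖ ^ 2) ≠ 0 := by positivity
      field_simp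
      ring⟩
    exact ⟨K, SobolevBound.of_one_sub_laplacian h2 hK⟩

theorem SobolevBound.exists_neg_laplacian {d : ℕ} {s : ℕ} {u : L2Rd d} {K : ℝ}
    (h : SobolevBound (s + 2) u K) :
    ∃ v K', SobolevBound s v K' ∧ ∀ᵐ ξ, ft v ξ = ((lapSymbol ξ : ℝ) : ℂ) * ft u ξ := by
  have key : ∀ S : Finset (Fin d), ∃ v K', SobolevBound s v K' ∧
      ∀ᵐ ξ, ft v ξ = ((∑ j ∈ S, linPhase (stdVec j) ξ ^ 2 : ℝ) : ℂ) * ft u ξ := by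
    intro S
    induction S using Finset.induction_on with
    | empty =>
      refine ⟨(0 : ℂ) • u, _, (h.anti (by omega)).smul 0, ?_⟩
      rw [zero_smul, map_zero]
      filter_upwards [Lp.coeFn_zero ℂ 2 (volume : Measure (Rd d))] with ξ hξ
      rw [hξ]; simp
    | insert j S hj ih =>
      obtain ⟨v, K', h1, h2⟩ := ih
      obtain ⟨w, hw, hw'⟩ := h.2 j
      obtain ⟨z, hz, hz'⟩ := hw'.2 j
      refine ⟨v + -z, _, h1.add hz'.neg, ?_⟩
      rw [map_add, map_neg]
      filter_upwards [h2, hw, hz, Lp.coeFn_add (ft v) (-ft z), Lp.coeFn_neg (ft z)]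
        with ξ a b c e f
      rw [e, Pi.add_apply, f, Pi.neg_apply, a, c, b, Finset.sum_insert hj]
      push_cast
      linear_combination -((linPhase (stdVec j) ξ : ℂ)) ^ 2 * ft u ξ * Complex.I_sq
  obtain ⟨v, K', h1, h2⟩ := key Finset.univ
  refine ⟨v, K', h1, ?_⟩
  filter_upwards [h2] with ξ a
  rw [a]
  rw [lapSymbol_eq_sum]

/-- One application of `H` leaves `2k - 2` orders of regularity, and multiplication by `V` preserves
these when `V` has `2k - 2` bounded derivatives; hence the exponent. -/
theorem mem_powDomain_schrodingerOp {d : ℕ} {V : Rd d → ℝ} {W : Rd d →ᵇ ℂ} (hW : ∀ x, W x = V x)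
    {k : ℕ} (hs : SmoothBound (2 * k - 2) W) {ψ : L2Rd d} {K : ℝ} (h : SobolevBound (2 * k) ψ K) :
    ψ ∈ powDomain (schrodingerOp V) k := by
  induction k generalizing ψ K with
  | zero => trivial
  | succ k ih =>
    obtain ⟨v, K', h1, h2⟩ := SobolevBound.exists_neg_laplacian (s := 2 * k) h
    obtain ⟨c, -, hc⟩ := SmoothBound.exists_mulOp_bound (s := 2 * k) hs
    refine mem_powDomain_succ_iff.mpr ⟨v + mulOp W ψ, ?_, ?_⟩
    · rw [mem_graph_schrodingerOp_iff hW, add_sub_cancel_right]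
      exact h2
    · exact ih (hs.anti (by omega)) (h1.add (hc ψ K (h.anti (by omega))))

/-- Since `(1 - Δ)ψ = Hψ - Vψ + ψ`, and both `Hψ` and `ψ` lie in the preceding power domain,
elliptic regularity adds two orders at each step. The three summands account for the three terms of
the new constant. -/
theorem exists_sobolevBound_of_mem_powDomain {d : ℕ} {V : Rd d → ℝ} {W : Rd d →ᵇ ℂ}
    (hW : ∀ x, W x = V x) {k : ℕ} (hs : SmoothBound (2 * k - 2) W) :
    ∃ C : ℝ, 0 ≤ C ∧ ∀ ψ ∈ powDomain (schrodingerOp V) k,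
      SobolevBound (2 * k) ψ (C * sumNormPow (schrodingerOp V) k ψ) := by
  induction k with
  | zero =>
    refine ⟨1, zero_le_one, fun ψ hψ => ?_⟩
    change ‖ψ‖ ≤ _
    unfold sumNormPow
    rw [zero_add, Finset.sum_range_one, dif_pos hψ, one_mul]
    rfl
  | succ k ih =>
    obtain ⟨C, hC0, hC⟩ := ih (hs.anti (by omega))
    obtain ⟨c, hc0, hc⟩ := SmoothBound.exists_mulOp_bound (s := 2 * k) hs
    refine ⟨C + c * C + C, by positivity, fun ψ hψ => ?_⟩
    obtain ⟨φ, h1, h2⟩ := mem_powDomain_succ_iff.mp hψ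
    have b1 := hC φ h2
    have b2 := hC ψ (powDomain_succ_subset hψ)
    have hle1 : sumNormPow (schrodingerOp V) k φ ≤ sumNormPow (schrodingerOp V) (k + 1) ψ := by
      rw [sumNormPow_succ h1 h2]
      linarith [norm_nonneg ψ]
    have hle2 := sumNormPow_mono (A := schrodingerOp V) (Nat.le_succ k) ψ
    have b3 := (b1.add (hc ψ _ b2).neg).add b2
    refine (SobolevBound.of_one_sub_laplacian (g := φ + -mulOp W ψ + ψ) ?_ b3).mono ?_
    · rw [mem_graph_schrodingerOp_iff hW] at h1
      rw [← sub_eq_add_neg, map_add]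
      filter_upwards [h1, Lp.coeFn_add (ft (φ - mulOp W ψ)) (ft ψ)] with ξ a b
      rw [b, Pi.add_apply, a]
      push_cast
      ring
    · have e1 := mul_le_mul_of_nonneg_left hle1 hC0
      have e2 := mul_le_mul_of_nonneg_left hle2 hC0
      have e3 := mul_le_mul_of_nonneg_left e2 hc0
      linarith

/-- The iterated derivatives in one direction. -/
theorem SobolevBound.exists_seq {d : ℕ} {s : ℕ} {u : L2Rd d} {K : ℝ} (h : SobolevBound s u K)
    (j : Fin d) : ∃ v : ℕ → L2Rd d, v 0 = u ∧ (∀ l < s, HasD (stdVec j) (v l) (v (l + 1))) ∧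
      ∀ l ≤ s, ‖v l‖ ≤ K := by
  induction s generalizing u with
  | zero =>
    exact ⟨fun _ => u, rfl, fun l hl => absurd hl (Nat.not_lt_zero l), fun _ _ => h⟩
  | succ s ih =>
    obtain ⟨w, h1, h2⟩ := h.2 j
    obtain ⟨v, hv0, hv1, hv2⟩ := ih h2
    refine ⟨fun l => Nat.casesOn l u v, rfl, fun l hl => ?_, fun l hl => ?_⟩
    · cases l with
      | zero => simpa [hv0] using h1
      | succ l => exact hv1 l (by omega)
    · cases l with
      | zero => exact h.1
      | succ l => exact hv2 l (by omega)

/-! ### Weighted interpolation -/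

theorem inner_mulOp_comm {d : ℕ} {g : Rd d →ᵇ ℂ} (hg : star g = g) (u v : L2Rd d) :
    inner ℂ (mulOp g u) v = inner ℂ u (mulOp g v) := by
  rw [inner_mulOp_left, hg]

/-- `w` is a real weight with derivative `w'` in the direction `e`, where `w' = 1 - δ²w²`
and `0 ≤ w' ≤ 1`, as for `w = δ⁻¹ tanh (δ x)`. -/
structure IsTanhWeight {d : ℕ} (e : Rd d) (δ : ℝ) (w w' : Rd d →ᵇ ℂ) : Prop where
  deriv : HasDirDeriv e w w'
  star_eq : star w = w
  norm_deriv_le : ∀ x, ‖w' x‖ ≤ 1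
  deriv_add : w' + ((δ ^ 2 : ℝ) : ℂ) • w ^ 2 = 1
  norm_le : ∀ x, δ ^ 2 * ‖w x‖ ≤ 1

theorem HasDirDeriv.pow_succ {d : ℕ} {e : Rd d} {w w' : Rd d →ᵇ ℂ} (h : HasDirDeriv e w w')
    (r : ℕ) : HasDirDeriv e (w ^ (r + 1)) (((r + 1 : ℕ) : ℂ) • (w ^ r * w')) := by
  intro x
  have h1 := (h x).pow (r + 1)
  simp only [Nat.add_sub_cancel, zero_smul, add_zero, mul_assoc] at h1
  exact h1

namespace IsTanhWeight

variable {d : ℕ} {e : Rd d} {δ : ℝ} {w w' : Rd d →ᵇ ℂ}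

theorem star_pow (hw : IsTanhWeight e δ w w') (r : ℕ) : star (w ^ r) = w ^ r := by
  rw [_root_.star_pow, hw.star_eq]

theorem norm_pow_mul_deriv_le (hw : IsTanhWeight e δ w w') (r : ℕ) (u : L2Rd d) :
    ‖mulOp (w ^ r * w') u‖ ≤ ‖mulOp (w ^ r) u‖ := by
  have := norm_mulOp_le_mul (g := w ^ r * w') (h := w ^ r) (c := 1) (fun x => by
    rw [BoundedContinuousFunction.mul_apply, norm_mul, one_mul]
    exact mul_le_of_le_one_right (norm_nonneg _) (hw.norm_deriv_le x)) u
  simpa using this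

theorem inner_pow_add (hw : IsTanhWeight e δ w w') (r s : ℕ) (g : Rd d →ᵇ ℂ) (u v : L2Rd d) :
    inner ℂ u (mulOp (w ^ (r + s) * g) v) = inner ℂ (mulOp (w ^ r) u) (mulOp (w ^ s * g) v) := by
  rw [inner_mulOp_comm (hw.star_pow r), ← mulOp_mul, ← mul_assoc, ← pow_add]

theorem norm_inner_pow_add_le (hw : IsTanhWeight e δ w w') (r s : ℕ) (u v : L2Rd d) :
    ‖inner ℂ u (mulOp (w ^ (r + s)) v)‖ ≤ ‖mulOp (w ^ r) u‖ * ‖mulOp (w ^ s) v‖ := by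
  have h := hw.inner_pow_add r s 1 u v
  rw [mul_one, mul_one] at h
  rw [h]
  exact norm_inner_le_norm _ _

theorem norm_inner_pow_add_deriv_le (hw : IsTanhWeight e δ w w') (r s : ℕ) (u v : L2Rd d) :
    ‖inner ℂ u (mulOp (w ^ (r + s) * w') v)‖ ≤ ‖mulOp (w ^ r) u‖ * ‖mulOp (w ^ s) v‖ := by
  rw [hw.inner_pow_add r s w' u v]
  exact (norm_inner_le_norm _ _).trans
    (mul_le_mul_of_nonneg_left (hw.norm_pow_mul_deriv_le s v) (norm_nonneg _))

theorem norm_sq_eq (hw : IsTanhWeight e δ w w') (r : ℕ) (u : L2Rd d) :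
    ‖mulOp (w ^ r) u‖ ^ 2 = ‖inner ℂ u (mulOp (w ^ (r + r)) u)‖ := by
  have h := hw.inner_pow_add r r 1 u u
  rw [mul_one, mul_one] at h
  rw [h, inner_self_eq_norm_sq_to_K]
  simp

/-- Integration by parts in `‖w^{r+1}∂u‖²`. -/
theorem norm_sq_deriv_le (hw : IsTanhWeight e δ w w') {u u' u'' : L2Rd d} (h1 : HasD e u u')
    (h2 : HasD e u' u'') (r : ℕ) :
    ‖mulOp (w ^ (r + 1)) u'‖ ^ 2 ≤ ‖mulOp (w ^ r) u''‖ * ‖mulOp (w ^ (r + 2)) u‖ +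
      2 * (r + 1) * (‖mulOp (w ^ r) u'‖ * ‖mulOp (w ^ (r + 1)) u‖) := by
  have hb := h2.boundedContinuous_mul (hw.deriv.pow_succ (2 * r + 1))
  have hI := h1.inner_left hb
  rw [inner_add_right, mulOp_smul, inner_smul_right] at hI
  have e1 : 2 * r + 1 + 1 = r + 1 + (r + 1) := by ring
  have e2 : 2 * r + 1 + 1 = r + 2 + r := by ring
  have e3 : 2 * r + 1 = r + 1 + r := by ring
  have b1 := hw.norm_inner_pow_add_le (r + 2) r u u''
  have b2 := hw.norm_inner_pow_add_deriv_le (r + 1) r u u'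
  rw [hw.norm_sq_eq, ← e1, hI, norm_neg]
  rw [← e2] at b1
  rw [← e3] at b2
  refine (norm_add_le _ _).trans ?_
  rw [norm_mul, Complex.norm_natCast]
  push_cast
  nlinarith [mul_le_mul_of_nonneg_left b2 (by positivity : (0 : ℝ) ≤ 2 * r + 1 + 1)]

/-- The uncertainty principle for the weight `w`. -/
theorem uncertainty (hw : IsTanhWeight e δ w w') {u u' : L2Rd d} (h1 : HasD e u u') (r : ℕ) :
    ‖mulOp (w ^ r) u‖ ^ 2 ≤ 2 * (‖mulOp (w ^ (r + 1)) u‖ * ‖mulOp (w ^ r) u'‖) +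
      ‖mulOp (w ^ (r + 1)) u‖ * ‖mulOp (w ^ r) u‖ := by
  have hb := h1.boundedContinuous_mul (hw.deriv.pow_succ (2 * r))
  have hI := h1.inner_left hb
  rw [inner_add_right, mulOp_smul, inner_smul_right] at hI
  have e1 : r + (r + 1) = 2 * r + 1 := by ring
  have e2 : r + 1 + r = 2 * r + 1 := by ring
  have b1 := hw.norm_inner_pow_add_le r (r + 1) u' u
  have b2 := hw.norm_inner_pow_add_le (r + 1) r u u'
  have b3 := hw.norm_inner_pow_add_le (r + 1) (r + 1) u u
  rw [e1] at b1
  rw [e2] at b2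
  -- For the unregularized weight `w' = 1`. Here `1 = w' + δ²w²`: the part with `w'` comes from the
  -- derivative of `w^{2r+1}`, and the part with `δ²w²` is harmless since `δ²|w| ≤ 1`. It is the
  -- source of the term without a derivative of `u`.
  have hdec : inner ℂ u (mulOp (w ^ (r + r)) u) = inner ℂ u (mulOp (w ^ (2 * r) * w') u) +
      ((δ ^ 2 : ℝ) : ℂ) * inner ℂ u (mulOp (w ^ (r + 1 + (r + 1))) u) := by
    rw [← inner_smul_right, ← mulOp_smul, ← inner_add_right, ← mulOp_add]
    congr 3
    calc w ^ (r + r) = w ^ (2 * r) * 1 := by rw [mul_one, two_mul]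
      _ = w ^ (2 * r) * (w' + ((δ ^ 2 : ℝ) : ℂ) • w ^ 2) := by rw [hw.deriv_add]
      _ = _ := by
        rw [mul_add, mul_smul_comm, ← pow_add]
        congr 3
        ring
  have c1 : ‖inner ℂ u (mulOp (w ^ (2 * r) * w') u)‖ ≤
      2 * (‖mulOp (w ^ (r + 1)) u‖ * ‖mulOp (w ^ r) u'‖) := by
    have h3 : ((2 * r + 1 : ℕ) : ℂ) * inner ℂ u (mulOp (w ^ (2 * r) * w') u) =
        -(inner ℂ u' (mulOp (w ^ (2 * r + 1)) u) + inner ℂ u (mulOp (w ^ (2 * r + 1)) u')) := by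
      rw [hI]; ring
    have h4 := congrArg norm h3
    rw [norm_mul, Complex.norm_natCast, norm_neg] at h4
    have h5 := norm_add_le (inner ℂ u' (mulOp (w ^ (2 * r + 1)) u))
      (inner ℂ u (mulOp (w ^ (2 * r + 1)) u'))
    have h6 : (1 : ℝ) ≤ ((2 * r + 1 : ℕ) : ℝ) := by exact_mod_cast Nat.succ_le_succ (Nat.zero_le _)
    nlinarith [mul_le_mul_of_nonneg_right h6
      (norm_nonneg (inner ℂ u (mulOp (w ^ (2 * r) * w') u)))]
  have c2 : δ ^ 2 * ‖mulOp (w ^ (r + 1)) u‖ ≤ ‖mulOp (w ^ r) u‖ := by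
    have := norm_mulOp_le_mul (g := ((δ ^ 2 : ℝ) : ℂ) • w ^ (r + 1)) (h := w ^ r) (c := 1)
      (fun x => by
        rw [BoundedContinuousFunction.smul_apply, norm_smul, Complex.norm_real, Real.norm_eq_abs,
          abs_of_nonneg (sq_nonneg δ), pow_succ w, BoundedContinuousFunction.mul_apply, norm_mul,
          one_mul]
        nlinarith [mul_le_mul_of_nonneg_left (hw.norm_le x) (norm_nonneg ((w ^ r) x))]) u
    rw [mulOp_smul, norm_smul, Complex.norm_real, Real.norm_eq_abs, abs_of_nonneg (sq_nonneg δ),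
      one_mul] at this
    exact this
  rw [hw.norm_sq_eq, hdec]
  refine (norm_add_le _ _).trans (add_le_add c1 ?_)
  rw [norm_mul, Complex.norm_real, Real.norm_eq_abs, abs_of_nonneg (sq_nonneg δ)]
  calc δ ^ 2 * ‖inner ℂ u (mulOp (w ^ (r + 1 + (r + 1))) u)‖
      ≤ δ ^ 2 * (‖mulOp (w ^ (r + 1)) u‖ * ‖mulOp (w ^ (r + 1)) u‖) :=
        mul_le_mul_of_nonneg_left b3 (sq_nonneg δ)
    _ = ‖mulOp (w ^ (r + 1)) u‖ * (δ ^ 2 * ‖mulOp (w ^ (r + 1)) u‖) := by ring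
    _ ≤ _ := mul_le_mul_of_nonneg_left c2 (norm_nonneg _)

end IsTanhWeight

/-! ### Log-convex sequences -/

/-- Raise the last inequality to the power `k + 1`, insert the induction hypothesis, and cancel a
power of `a (k + 1)`. If that entry vanishes, the claim is trivial. -/
theorem exists_pow_succ_le_of_log_convex {D : ℝ} (hD : 0 ≤ D) (k : ℕ) :
    ∃ C : ℝ, 0 ≤ C ∧ ∀ a : ℕ → ℝ, (∀ i, 0 ≤ a i) →
      (∀ i < k, a (i + 1) ^ 2 ≤ D * (a i * a (i + 2))) →
      a k ^ (k + 1) ≤ C * (a 0 * a (k + 1) ^ k) := by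
  induction k with
  | zero => exact ⟨1, zero_le_one, fun a _ _ => by simp⟩
  | succ k ih =>
    obtain ⟨C, hC0, hC⟩ := ih
    refine ⟨D ^ (k + 1) * C, by positivity, fun a ha h => ?_⟩
    have h1 := hC a ha fun i hi => h i (by omega)
    have h2 := h k (by omega)
    rcases (ha (k + 1)).eq_or_lt with h0 | hpos
    · rw [← h0, zero_pow (by omega)]
      have := ha 0
      have := ha (k + 2)
      positivity
    · have h3 := pow_le_pow_left₀ (sq_nonneg _) h2 (k + 1)
      have h4 : a (k + 1) ^ k * a (k + 1) ^ (k + 1 + 1) ≤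
          a (k + 1) ^ k * (D ^ (k + 1) * C * (a 0 * a (k + 1 + 1) ^ (k + 1))) := by
        calc a (k + 1) ^ k * a (k + 1) ^ (k + 1 + 1) = (a (k + 1) ^ 2) ^ (k + 1) := by
              rw [← pow_add, ← pow_mul]; congr 1; ring
          _ ≤ (D * (a k * a (k + 2))) ^ (k + 1) := h3
          _ = D ^ (k + 1) * (a k ^ (k + 1)) * a (k + 2) ^ (k + 1) := by
              rw [mul_pow, mul_pow]; ring
          _ ≤ D ^ (k + 1) * (C * (a 0 * a (k + 1) ^ k)) * a (k + 2) ^ (k + 1) := by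
              have := ha (k + 2)
              gcongr
          _ = _ := by ring
      exact le_of_mul_le_mul_left h4 (by positivity)

theorem exists_pow_le_of_log_convex {D : ℝ} (hD : 0 ≤ D) (k : ℕ) :
    ∃ C : ℝ, 0 ≤ C ∧ ∀ a : ℕ → ℝ, (∀ i, 0 ≤ a i) →
      (∀ i < k, a (i + 1) ^ 2 ≤ D * (a i * a (i + 2))) →
      a 1 ^ (k + 1) ≤ C * (a 0 ^ k * a (k + 1)) := by
  induction k with
  | zero => exact ⟨1, zero_le_one, fun a _ _ => by simp⟩
  | succ k ih =>
    obtain ⟨C, hC0, hC⟩ := ih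
    obtain ⟨C', hC0', hC'⟩ := exists_pow_succ_le_of_log_convex hD (k + 1)
    -- The comparison is made after raising to the power `k + 1`. The maximum with `1` is at most
    -- its own power, which avoids taking a root of the constant.
    refine ⟨max 1 (C ^ (k + 2) * C'), by positivity, fun a ha h => ?_⟩
    have h1 := hC a ha fun i hi => h i (by omega)
    have h2 := hC' a ha h
    have h0 := ha 0
    have h3 := ha (k + 2)
    have h4 := ha (k + 1)
    have h5 := ha 1
    refine le_of_pow_le_pow_left₀ (n := k + 1) (by omega) (by positivity) ?_
    calc (a 1 ^ (k + 1 + 1)) ^ (k + 1) = (a 1 ^ (k + 1)) ^ (k + 2) := by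
          rw [← pow_mul, ← pow_mul]; congr 1; ring
      _ ≤ (C * (a 0 ^ k * a (k + 1))) ^ (k + 2) := pow_le_pow_left₀ (by positivity) h1 _
      _ = C ^ (k + 2) * (a 0 ^ (k * (k + 2)) * a (k + 1) ^ (k + 1 + 1)) := by
          rw [mul_pow, mul_pow, ← pow_mul]
      _ ≤ C ^ (k + 2) * (a 0 ^ (k * (k + 2)) * (C' * (a 0 * a (k + 1 + 1) ^ (k + 1)))) := by
          gcongr
      _ = C ^ (k + 2) * C' * (a 0 ^ (k + 1) * a (k + 1 + 1)) ^ (k + 1) := by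
          rw [mul_pow, ← pow_mul]
          have : (k + 1) * (k + 1) = k * (k + 2) + 1 := by ring
          rw [this, _root_.pow_succ]
          ring
      _ ≤ max 1 (C ^ (k + 2) * C') ^ (k + 1) * (a 0 ^ (k + 1) * a (k + 1 + 1)) ^ (k + 1) := by
          have hm : C ^ (k + 2) * C' ≤ max 1 (C ^ (k + 2) * C') ^ (k + 1) :=
            (le_max_right _ _).trans (le_self_pow₀ (le_max_left _ _) (by omega))
          gcongr
      _ = _ := by rw [← mul_pow]

/-- Interpolation for an array of seminorms `N r l = ‖w^r ∂^l u‖`. -/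
theorem exists_interpolation (m : ℕ) :
    ∃ C : ℝ, 0 ≤ C ∧ ∀ N : ℕ → ℕ → ℝ, (∀ r l, 0 ≤ N r l) →
      (∀ r l, l + 2 ≤ m + 1 → N (r + 1) (l + 1) ^ 2 ≤
        N r (l + 2) * N (r + 2) l + 2 * (r + 1) * (N r (l + 1) * N (r + 1) l)) →
      (∀ r, N (r + 1) 0 ^ 2 ≤ N r 0 * N (r + 2) 0) →
      (∀ r l, l + 1 ≤ m + 1 →
        N r l ^ 2 ≤ 2 * (N (r + 1) l * N r (l + 1)) + N (r + 1) l * N r l) →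
      N m 1 ^ (m + 1) ≤ C * (N (m + 1) 0 ^ m * ∑ l ∈ Finset.range (m + 2), N 0 l) := by
  set c1 : ℝ := ((m + 2 : ℕ) : ℝ) ^ 2 with hc1
  set c2 : ℝ := 3 * c1 with hc2
  set c3 : ℝ := c1 * (2 * (m + 1) * c2) with hc3
  have hc1p : 0 ≤ c1 := by positivity
  have hc3p : 0 ≤ c3 := by positivity
  obtain ⟨C, hC0, hC⟩ := exists_pow_le_of_log_convex
    (D := 2 * c1 + c3 ^ 2) (by positivity) m
  refine ⟨C, hC0, fun N hN hA hA0 hB => ?_⟩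
  -- Summing over all derivatives up to order `k` absorbs the lower-order term of the uncertainty
  -- inequality, so that both inequalities become homogeneous in `M`.
  let M : ℕ → ℕ → ℝ := fun r k => ∑ l ∈ Finset.range (k + 1), N r l
  have hM0 : ∀ r k, 0 ≤ M r k := fun r k => Finset.sum_nonneg fun l _ => hN r l
  have hNM : ∀ r l k, l ≤ k → N r l ≤ M r k := fun r l k h =>
    Finset.single_le_sum (f := fun l => N r l) (fun l _ => hN r l)
      (Finset.mem_range.mpr (Nat.lt_succ_of_le h))
  have hsq : ∀ r k (X : ℝ), k + 1 ≤ m + 2 → 0 ≤ X → (∀ l ≤ k, N r l ^ 2 ≤ X) →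
      M r k ^ 2 ≤ c1 * X := by
    intro r k X hk hX h
    have h1 := sq_sum_le_card_mul_sum_sq (s := Finset.range (k + 1)) (f := fun l => N r l)
    have h2 : ∑ l ∈ Finset.range (k + 1), N r l ^ 2 ≤ (k + 1 : ℕ) * X := by
      have := Finset.sum_le_card_nsmul (Finset.range (k + 1)) (fun l => N r l ^ 2) X
        fun l hl => h l (Nat.lt_succ_iff.mp (Finset.mem_range.mp hl))
      simpa using this
    rw [Finset.card_range] at h1
    have h3 : ((k + 1 : ℕ) : ℝ) ≤ ((m + 2 : ℕ) : ℝ) := by exact_mod_cast hk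
    calc M r k ^ 2 ≤ ((k + 1 : ℕ) : ℝ) * (((k + 1 : ℕ) : ℝ) * X) :=
          h1.trans (mul_le_mul_of_nonneg_left h2 (by positivity))
      _ ≤ ((m + 2 : ℕ) : ℝ) * (((m + 2 : ℕ) : ℝ) * X) := by gcongr
      _ = c1 * X := by rw [hc1]; ring
  have hB' : ∀ r k, k + 1 ≤ m + 1 → M r k ^ 2 ≤ c2 * (M (r + 1) k * M r (k + 1)) := by
    intro r k hk
    have hX : 0 ≤ M (r + 1) k * M r (k + 1) := mul_nonneg (hM0 _ _) (hM0 _ _)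
    refine (hsq r k (3 * (M (r + 1) k * M r (k + 1))) (by omega) (by positivity)
      fun l hl => ?_).trans (le_of_eq (by rw [hc2]; ring))
    refine (hB r l (by omega)).trans ?_
    have i1 := mul_le_mul (hNM (r + 1) l k hl) (hNM r (l + 1) (k + 1) (by omega)) (hN _ _) (hM0 _ _)
    have i2 := mul_le_mul (hNM (r + 1) l k hl) (hNM r l (k + 1) (by omega)) (hN _ _) (hM0 _ _)
    linarith
  have hA' : ∀ r k, k + 2 ≤ m + 1 → r ≤ m →
      M (r + 1) (k + 1) ^ 2 ≤ (2 * c1 + c3 ^ 2) * (M (r + 2) k * M r (k + 2)) := by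
    intro r k hk hr
    set A := M (r + 1) (k + 1) with hAdef
    set P := M (r + 2) k * M r (k + 2) with hP
    set Q := M r (k + 1) * M (r + 1) k with hQ
    have hA0' : 0 ≤ A := hM0 _ _
    have hP0 : 0 ≤ P := mul_nonneg (hM0 _ _) (hM0 _ _)
    have hQ0 : 0 ≤ Q := mul_nonneg (hM0 _ _) (hM0 _ _)
    have s1 : A ^ 2 ≤ c1 * (P + 2 * (m + 1) * Q) := by
      refine hsq (r + 1) (k + 1) _ (by omega) (by positivity) fun l hl => ?_
      have hrm : (r : ℝ) ≤ m := by exact_mod_cast hr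
      cases l with
      | zero =>
        refine (hA0 r).trans ?_
        have := mul_le_mul (hNM r 0 (k + 2) (by omega)) (hNM (r + 2) 0 k (by omega))
          (hN _ _) (hM0 _ _)
        have : 0 ≤ 2 * ((m : ℝ) + 1) * Q := by positivity
        linarith [mul_comm (M r (k + 2)) (M (r + 2) k)]
      | succ l =>
        refine (hA r l (by omega)).trans ?_
        have i1 := mul_le_mul (hNM r (l + 2) (k + 2) (by omega)) (hNM (r + 2) l k (by omega))
          (hN _ _) (hM0 _ _)
        have i2 := mul_le_mul (hNM r (l + 1) (k + 1) (by omega)) (hNM (r + 1) l k (by omega))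
          (hN _ _) (hM0 _ _)
        have i3 : 2 * ((r : ℝ) + 1) * (N r (l + 1) * N (r + 1) l) ≤ 2 * (m + 1) * Q := by
          apply mul_le_mul _ i2 (mul_nonneg (hN _ _) (hN _ _)) (by positivity)
          linarith
        linarith [mul_comm (M r (k + 2)) (M (r + 2) k)]
    -- The uncertainty inequality applied to each factor of the error `Q` gives `Q ≤ c2 A √P`. The
    -- resulting quadratic inequality `A² ≤ c1 P + c3 A √P` then absorbs `A` and leaves `A² ≤ (2 c1
    -- + c3²) P`.
    have s2 : Q ^ 2 ≤ c2 ^ 2 * (A ^ 2 * P) := by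
      have j1 := hB' r (k + 1) (by omega)
      have j2 := hB' (r + 1) k (by omega)
      have j3 := mul_le_mul j1 j2 (sq_nonneg _)
        (mul_nonneg (by positivity) (mul_nonneg (hM0 _ _) (hM0 _ _)))
      calc Q ^ 2 = M r (k + 1) ^ 2 * M (r + 1) k ^ 2 := by rw [hQ, mul_pow]
        _ ≤ _ := j3
        _ = _ := by rw [hP, hAdef]; ring
    have s3 : Q ≤ c2 * (A * √P) := by
      refine le_of_sq_le_sq (h := ?_) (by positivity)
      rw [mul_pow c2, mul_pow A, Real.sq_sqrt hP0]
      exact s2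
    have s4 : A ^ 2 ≤ c1 * P + c3 * (A * √P) := by
      have : c1 * (2 * (m + 1) * Q) ≤ c1 * (2 * (m + 1) * (c2 * (A * √P))) := by gcongr
      calc A ^ 2 ≤ c1 * P + c1 * (2 * (m + 1) * Q) := by linarith
        _ ≤ c1 * P + c1 * (2 * (m + 1) * (c2 * (A * √P))) := by linarith
        _ = _ := by rw [hc3]; ring
    have s5 := Real.sq_sqrt hP0
    nlinarith [sq_nonneg (A - c3 * √P)]
  -- Along the diagonal one power of the weight is traded for one derivative: the first entry is `N
  -- (m + 1) 0`, the second dominates `N m 1`, and the last is the sum of unweighted norms.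
  have hfin := hC (fun k => M (m + 1 - k) k) (fun i => hM0 _ _) (fun i hi => by
    have h1 := hA' (m - (i + 1)) i (by omega) (by omega)
    have e1 : m + 1 - (i + 1) = m - (i + 1) + 1 := by omega
    have e2 : m + 1 - i = m - (i + 1) + 2 := by omega
    have e3 : m + 1 - (i + 2) = m - (i + 1) := by omega
    simp only [e1, e2, e3]
    exact h1)
  have g1 : N m 1 ≤ M (m + 1 - 1) 1 := by
    rw [Nat.add_sub_cancel]
    exact hNM m 1 1 le_rfl
  refine (pow_le_pow_left₀ (hN m 1) g1 (m + 1)).trans (hfin.trans (le_of_eq ?_))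
  simp [M]

theorem IsTanhWeight.norm_sq_pow_le {d : ℕ} {e : Rd d} {δ : ℝ} {w w' : Rd d →ᵇ ℂ}
    (hw : IsTanhWeight e δ w w') (u : L2Rd d) (r : ℕ) :
    ‖mulOp (w ^ (r + 1)) u‖ ^ 2 ≤ ‖mulOp (w ^ r) u‖ * ‖mulOp (w ^ (r + 2)) u‖ := by
  have h := hw.norm_inner_pow_add_le r (r + 2) u u
  rw [hw.norm_sq_eq]
  have e1 : r + 1 + (r + 1) = r + (r + 2) := by ring
  rw [e1]
  exact h

/-! ### The regularized coordinate functions -/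

theorem Real.one_sub_tanh_sq_mem (x : ℝ) : 0 ≤ 1 - Real.tanh x ^ 2 ∧ 1 - Real.tanh x ^ 2 ≤ 1 := by
  have h := (sq_lt_one_iff_abs_lt_one _).mpr (Real.abs_tanh_lt_one x)
  exact ⟨by linarith, by linarith [sq_nonneg (Real.tanh x)]⟩

theorem Real.hasDerivAt_tanh_one_sub_sq (x : ℝ) :
    HasDerivAt Real.tanh (1 - Real.tanh x ^ 2) x := by
  have hc : Real.cosh x ≠ 0 := (Real.cosh_pos x).ne'
  have h := (Real.hasDerivAt_sinh x).div (Real.hasDerivAt_cosh x) hc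
  have e : Real.tanh = Real.sinh / Real.cosh := by
    ext y; simp [Real.tanh_eq_sinh_div_cosh]
  rw [e]
  convert! h using 1
  rw [Pi.div_apply]
  field_simp

theorem Real.abs_tanh_le (x : ℝ) : |Real.tanh x| ≤ |x| := by
  have := Convex.norm_image_sub_le_of_norm_hasDerivWithin_le (s := Set.univ)
    (f := Real.tanh) (f' := fun x => 1 - Real.tanh x ^ 2) (C := 1) (x := 0) (y := x)
    (fun y _ => (Real.hasDerivAt_tanh_one_sub_sq y).hasDerivWithinAt)
    (fun y _ => by
      obtain ⟨h1, h2⟩ := Real.one_sub_tanh_sq_mem y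
      rw [Real.norm_eq_abs, abs_of_nonneg h1]
      exact h2)
    convex_univ trivial trivial
  simpa using this

/-- The bounded weight `δ⁻¹ tanh (δ x_j)`. -/
noncomputable def tanhWeight {d : ℕ} (j : Fin d) (δ : ℝ) : Rd d →ᵇ ℂ :=
  BoundedContinuousFunction.ofNormedAddCommGroup (fun x => ((δ⁻¹ * Real.tanh (δ * x j) : ℝ) : ℂ))
    (Complex.continuous_ofReal.comp (continuous_const.mul
      ((continuous_iff_continuousAt.mpr fun y =>
        (Real.hasDerivAt_tanh_one_sub_sq y).continuousAt).comp (by fun_prop))))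
    |δ⁻¹| (fun x => by
      rw [Complex.norm_real, norm_mul, Real.norm_eq_abs, Real.norm_eq_abs]
      exact mul_le_of_le_one_right (abs_nonneg _) (Real.abs_tanh_lt_one _).le)

theorem tanhWeight_apply {d : ℕ} (j : Fin d) (δ : ℝ) (x : Rd d) :
    tanhWeight j δ x = ((δ⁻¹ * Real.tanh (δ * x j) : ℝ) : ℂ) := rfl

theorem norm_tanhWeight_le {d : ℕ} (j : Fin d) {δ : ℝ} (hδ : 0 < δ) (x : Rd d) :
    ‖tanhWeight j δ x‖ ≤ |x j| := by
  rw [tanhWeight_apply, Complex.norm_real, Real.norm_eq_abs, abs_mul, abs_inv, abs_of_pos hδ,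
    inv_mul_le_iff₀ hδ]
  simpa [abs_mul, abs_of_pos hδ] using Real.abs_tanh_le (δ * x j)

theorem tendsto_tanhWeight {d : ℕ} (j : Fin d) (x : Rd d) :
    Tendsto (fun δ => tanhWeight j δ x) (𝓝[≠] 0) (𝓝 (x j : ℂ)) := by
  have h0 : HasDerivAt (fun δ : ℝ => Real.tanh (δ * x j)) (x j) 0 := by
    have h1 : HasDerivAt (fun δ : ℝ => δ * x j) (x j) 0 := by
      simpa using (hasDerivAt_id (0 : ℝ)).mul_const (x j)
    have h2 := Real.hasDerivAt_tanh_one_sub_sq (0 * x j)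
    have h3 := HasDerivAt.comp (0 : ℝ) h2 h1
    simp only [zero_mul, Real.tanh_zero, ne_eq, OfNat.ofNat_ne_zero, not_false_eq_true, zero_pow,
      sub_zero, one_mul] at h3
    exact h3
  rw [hasDerivAt_iff_tendsto_slope_zero] at h0
  have h4 := (Complex.continuous_ofReal.tendsto _).comp h0
  refine h4.congr fun δ => ?_
  simp [tanhWeight_apply]

theorem isTanhWeight_tanhWeight {d : ℕ} (j : Fin d) {δ : ℝ} (hδ : 0 < δ) (hδ1 : δ ≤ 1) :
    IsTanhWeight (stdVec j) δ (tanhWeight j δ)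
      (1 + (-1 : ℂ) • ((δ ^ 2 : ℝ) : ℂ) • tanhWeight j δ ^ 2) := by
  have hw' : ∀ x, (1 + (-1 : ℂ) • ((δ ^ 2 : ℝ) : ℂ) • tanhWeight j δ ^ 2 : Rd d →ᵇ ℂ) x =
      ((1 - Real.tanh (δ * x j) ^ 2 : ℝ) : ℂ) := by
    intro x
    have : δ ^ 2 * (δ⁻¹ * Real.tanh (δ * x j)) ^ 2 = Real.tanh (δ * x j) ^ 2 := by
      field_simp
    simp only [BoundedContinuousFunction.add_apply, BoundedContinuousFunction.coe_one, Pi.one_apply,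
      BoundedContinuousFunction.smul_apply, BoundedContinuousFunction.pow_apply, tanhWeight_apply,
      smul_eq_mul]
    rw [← this]
    push_cast
    ring
  refine ⟨fun x => ?_, ?_, fun x => ?_, ?_, fun x => ?_⟩
  · rw [hw']
    have h1 : HasDerivAt (fun t : ℝ => δ * (x + t • stdVec j) j) δ 0 := by
      have : HasDerivAt (fun t : ℝ => δ * (x j + t)) δ 0 := by
        simpa using ((hasDerivAt_id (0 : ℝ)).const_add (x j)).const_mul δ
      simpa using this
    have h2 := Real.hasDerivAt_tanh_one_sub_sq (δ * (x + (0 : ℝ) • stdVec j) j)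
    have h3 := ((HasDerivAt.comp (0 : ℝ) h2 h1).const_mul δ⁻¹).ofReal_comp
    have e : δ⁻¹ * ((1 - Real.tanh (δ * (x + (0 : ℝ) • stdVec j) j) ^ 2) * δ) =
        1 - Real.tanh (δ * x j) ^ 2 := by
      simp only [zero_smul, add_zero]
      field_simp
    rw [e] at h3
    exact h3
  · ext x
    rw [BoundedContinuousFunction.star_apply, tanhWeight_apply]
    exact Complex.conj_ofReal _
  · obtain ⟨h1, h2⟩ := Real.one_sub_tanh_sq_mem (δ * x j)
    rw [hw', Complex.norm_real, Real.norm_eq_abs, abs_of_nonneg h1]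
    exact h2
  · module
  · rw [tanhWeight_apply, Complex.norm_real, norm_mul, norm_inv, Real.norm_eq_abs, abs_of_pos hδ,
      Real.norm_eq_abs]
    have := (Real.abs_tanh_lt_one (δ * x j)).le
    have h2 : δ ^ 2 * (δ⁻¹ * |Real.tanh (δ * x j)|) = δ * |Real.tanh (δ * x j)| := by
      field_simp
    rw [h2]
    nlinarith [abs_nonneg (Real.tanh (δ * x j))]

theorem hasDirDeriv_tanhWeight_of_ne {d : ℕ} {i j : Fin d} (hij : i ≠ j) (δ : ℝ) :
    HasDirDeriv (stdVec i) (tanhWeight j δ) 0 := by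
  intro x
  have : (fun t : ℝ => tanhWeight j δ (x + t • stdVec i)) = fun _ => tanhWeight j δ x := by
    ext t
    simp [tanhWeight_apply, hij.symm]
  rw [this]
  exact hasDerivAt_const _ _

/-! ### The energy estimate -/

theorem mulOp_zero {d : ℕ} (u : L2Rd d) : mulOp (0 : Rd d →ᵇ ℂ) u = 0 := by
  simpa using mulOp_smul (0 : ℂ) (0 : Rd d →ᵇ ℂ) u

theorem im_inner_mulOp_self {d : ℕ} {g : Rd d →ᵇ ℂ} (hg : star g = g) (u : L2Rd d) :
    (inner ℂ u (mulOp g u)).im = 0 := by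
  rw [← Complex.conj_eq_iff_im, inner_conj_symm, inner_mulOp_comm hg]

theorem coeFn_ft_sum {d : ℕ} {ι : Type*} (S : Finset ι) (q : ι → L2Rd d) :
    ∀ᵐ ξ, ft (∑ k ∈ S, q k) ξ = ∑ k ∈ S, ft (q k) ξ := by
  classical
  induction S using Finset.induction_on with
  | empty =>
    rw [Finset.sum_empty, map_zero]
    filter_upwards [Lp.coeFn_zero ℂ 2 (volume : Measure (Rd d))] with ξ hξ
    rw [hξ]; simp
  | insert j S hj ih =>
    rw [Finset.sum_insert hj, map_add]
    filter_upwards [ih, Lp.coeFn_add (ft (q j)) (ft (∑ k ∈ S, q k))] with ξ a b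
    rw [b, Pi.add_apply, a, Finset.sum_insert hj]

theorem eq_neg_sum_of_ft_eq_lapSymbol {d : ℕ} {ψ χ : L2Rd d} {p q : Fin d → L2Rd d}
    (hχ : ∀ᵐ ξ, ft χ ξ = ((lapSymbol ξ : ℝ) : ℂ) * ft ψ ξ)
    (hp : ∀ j, HasD (stdVec j) ψ (p j)) (hq : ∀ j, HasD (stdVec j) (p j) (q j)) :
    χ = -∑ j, q j := by
  apply ft.injective
  apply Lp.ext
  rw [map_neg]
  filter_upwards [hχ, coeFn_ft_sum Finset.univ q, ae_all_iff.mpr hp, ae_all_iff.mpr hq,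
    Lp.coeFn_neg (ft (∑ j, q j))] with ξ a b c e f
  rw [f, Pi.neg_apply, a, b, lapSymbol_eq_sum, Complex.ofReal_sum, Finset.sum_mul,
    ← Finset.sum_neg_distrib]
  refine Finset.sum_congr rfl fun j _ => ?_
  rw [e j, c j]
  push_cast
  linear_combination (linPhase (stdVec j) ξ : ℂ) ^ 2 * ft ψ ξ * Complex.I_sq

/-- Only the commutator of `-∂_j²` with the weight has an imaginary part. The derivative `2(n+1)
w^{2n+1} w'` is split so that `w^n` goes to `∂_j ψ` and `w^{n+1}` to `ψ`. -/
theorem abs_im_inner_schrodinger_le {d : ℕ} {V : Rd d → ℝ} {W : Rd d →ᵇ ℂ}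
    (hW : ∀ x, W x = V x) {ψ φ : L2Rd d} (h : (ψ, φ) ∈ (schrodingerOp V).graph) {K : ℝ}
    (hK : SobolevBound 2 ψ K) {j : Fin d} {δ : ℝ} {w w' : Rd d →ᵇ ℂ}
    (hw : IsTanhWeight (stdVec j) δ w w') (hwi : ∀ i, i ≠ j → HasDirDeriv (stdVec i) w 0)
    {p : L2Rd d} (hp : HasD (stdVec j) ψ p) (n : ℕ) :
    |(inner ℂ φ (mulOp (w ^ (n + 1 + (n + 1))) ψ)).im| ≤
      2 * (n + 1) * (‖mulOp (w ^ (n + 1)) ψ‖ * ‖mulOp (w ^ n) p‖) := by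
  set g := w ^ (n + 1 + (n + 1)) with hg
  have hgs : star g = g := hw.star_pow _
  have hWs : star W = W := by ext x; simp [hW]
  choose P hP hP' using hK.2
  choose q hq _ using fun i => (hP' i).2 i
  have hPj : P j = p := (hP j).unique hp
  have hχ := eq_neg_sum_of_ft_eq_lapSymbol ((mem_graph_schrodingerOp_iff hW).mp h) hP hq
  have hφ : φ = mulOp W ψ + -∑ i, q i := by rw [← hχ]; abel
  have hV : (inner ℂ (mulOp W ψ) (mulOp g ψ)).im = 0 := by
    rw [inner_mulOp_comm hWs, ← mulOp_mul]
    apply im_inner_mulOp_self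
    rw [star_mul, hgs, hWs, mul_comm]
  have hgi : ∀ i, i ≠ j → HasDirDeriv (stdVec i) g 0 := by
    intro i hi
    have := (hwi i hi).pow_succ (n + 1 + n)
    rw [mul_zero, smul_zero] at this
    exact this
  have hq0 : ∀ i, i ≠ j → (inner ℂ (q i) (mulOp g ψ)).im = 0 := by
    intro i hi
    rw [(hq i).inner_left ((hP i).boundedContinuous_mul (hgi i hi)), mulOp_zero, zero_add,
      Complex.neg_im, im_inner_mulOp_self hgs, neg_zero]
  have hqj : (inner ℂ (q j) (mulOp g ψ)).im =
      -((n + 1 + n + 1 : ℕ) * inner ℂ p (mulOp (w ^ (n + (n + 1)) * w') ψ)).im := by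
    have hg' : g = w ^ (n + 1 + n + 1) := by rw [hg]; congr 1
    rw [hg', (hq j).inner_left ((hP j).boundedContinuous_mul (hw.deriv.pow_succ (n + 1 + n))),
      inner_add_right, Complex.neg_im, Complex.add_im, im_inner_mulOp_self (hw.star_pow _),
      add_zero, mulOp_smul, inner_smul_right, hPj]
    congr 5
    ring_nf
  have hsum : (inner ℂ φ (mulOp g ψ)).im = -(inner ℂ (q j) (mulOp g ψ)).im := by
    rw [hφ, inner_add_left, Complex.add_im, hV, zero_add, inner_neg_left, Complex.neg_im,
      sum_inner, Complex.im_sum, Finset.sum_eq_single j (fun i _ hi => hq0 i hi)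
      (fun hj => absurd (Finset.mem_univ j) hj)]
  rw [hsum, hqj, neg_neg]
  refine (Complex.abs_im_le_norm _).trans ?_
  rw [norm_mul, Complex.norm_natCast]
  have hb := hw.norm_inner_pow_add_deriv_le n (n + 1) p ψ
  push_cast
  nlinarith [mul_le_mul_of_nonneg_left hb (by positivity : (0 : ℝ) ≤ n + 1 + n + 1)]

/-! ### The differential inequality -/

/-- The function `G = F^{1/(2(n+1))}` satisfies `G' ≤ 2B`: the exponent is the one for which all
powers of `F` cancel. Adding `η > 0` keeps `G` differentiable where `F` vanishes. No regularity of
`b` in time is needed. -/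
theorem sqrt_le_of_deriv_le {F F' b : ℝ → ℝ} {B : ℝ} {n : ℕ} (hF0 : ∀ t, 0 ≤ F t)
    (hF : ∀ t, HasDerivAt F (F' t) t) (hb0 : ∀ t, 0 ≤ b t) (hB : 0 ≤ B)
    (hF' : ∀ t, F' t ≤ 4 * (n + 1) * (√(F t) * b t))
    (hb : ∀ t, b t ^ (n + 1) ≤ B ^ (n + 1) * √(F t) ^ n) {t : ℝ} (ht : 0 ≤ t) :
    √(F t) ≤ 2 ^ n * (√(F 0) + (2 * B * t) ^ (n + 1)) := by
  set p : ℝ := 1 / (2 * (n + 1)) with hp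
  have hp0 : 0 < p := by positivity
  have main : ∀ η : ℝ, 0 < η → √(F t) ≤ 2 ^ n * (√(F 0 + η) + (2 * B * t) ^ (n + 1)) := by
    intro η hη
    have hpos : ∀ s, 0 < F s + η := fun s => by linarith [hF0 s]
    let G : ℝ → ℝ := fun s => (F s + η) ^ p
    have hGd : ∀ s, HasDerivAt G (F' s * p * (F s + η) ^ (p - 1)) s := fun s =>
      ((hF s).add_const η).rpow_const (Or.inl (hpos s).ne')
    have hGpow : ∀ s, G s ^ (n + 1) = √(F s + η) := by
      intro s
      rw [← Real.rpow_natCast, ← Real.rpow_mul (hpos s).le, Real.sqrt_eq_rpow]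
      congr 1
      rw [hp]
      push_cast
      field_simp
    have hsq : ∀ s, √(F s) ≤ √(F s + η) := fun s => Real.sqrt_le_sqrt (by linarith)
    have hG0 : ∀ s, 0 < G s := fun s => Real.rpow_pos_of_pos (hpos s) p
    have hbG : ∀ s, b s ≤ B * G s ^ n := by
      intro s
      refine le_of_pow_le_pow_left₀ (n := n + 1) (by omega)
        (mul_nonneg hB (pow_nonneg (hG0 s).le n)) ?_
      refine (hb s).trans ?_
      rw [mul_pow, ← pow_mul, mul_comm n, pow_mul, hGpow]
      have := hsq s
      gcongr
    have hderiv : ∀ s, F' s * p * (F s + η) ^ (p - 1) ≤ 2 * B := by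
      intro s
      have h1 : F' s ≤ 4 * (n + 1) * (√(F s + η) * (B * G s ^ n)) := by
        refine (hF' s).trans ?_
        have := hsq s
        have := hbG s
        have := hb0 s
        gcongr
      have h2 : (F s + η) ^ (p - 1) * (√(F s + η) * G s ^ n) = 1 := by
        have e1 : G s ^ n = (F s + η) ^ (p * n) := by
          rw [← Real.rpow_natCast, ← Real.rpow_mul (hpos s).le]
        rw [e1, Real.sqrt_eq_rpow, ← Real.rpow_add (hpos s), ← Real.rpow_add (hpos s)]
        have : p - 1 + (1 / 2 + p * n) = 0 := by
          rw [hp]; field_simp; ring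
        rw [this, Real.rpow_zero]
      have h3 : 0 ≤ p * (F s + η) ^ (p - 1) :=
        mul_nonneg hp0.le (Real.rpow_nonneg (hpos s).le _)
      have h4 : 4 * ((n : ℝ) + 1) * p = 2 := by
        rw [hp]; field_simp; norm_num
      calc F' s * p * (F s + η) ^ (p - 1) = F' s * (p * (F s + η) ^ (p - 1)) := by ring
        _ ≤ 4 * (n + 1) * (√(F s + η) * (B * G s ^ n)) * (p * (F s + η) ^ (p - 1)) :=
            mul_le_mul_of_nonneg_right h1 h3
        _ = 4 * (n + 1) * p * B * ((F s + η) ^ (p - 1) * (√(F s + η) * G s ^ n)) := by ring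
        _ = 2 * B := by rw [h2, h4, mul_one]
    have hle := image_sub_le_mul_sub_of_deriv_le (fun s => (hGd s).differentiableAt)
      (fun s => by rw [(hGd s).deriv]; exact hderiv s) ht
    rw [sub_zero] at hle
    have h5 : G t ≤ G 0 + 2 * B * t := by linarith
    calc √(F t) ≤ √(F t + η) := hsq t
      _ = G t ^ (n + 1) := (hGpow t).symm
      _ ≤ (G 0 + 2 * B * t) ^ (n + 1) := pow_le_pow_left₀ (hG0 t).le h5 _
      _ ≤ 2 ^ (n + 1 - 1) * (G 0 ^ (n + 1) + (2 * B * t) ^ (n + 1)) :=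
          add_pow_le (hG0 0).le (by positivity) _
      _ = _ := by rw [hGpow, Nat.add_sub_cancel]
  have hlim : Tendsto (fun η : ℝ => 2 ^ n * (√(F 0 + η) + (2 * B * t) ^ (n + 1))) (𝓝[>] 0)
      (𝓝 (2 ^ n * (√(F 0) + (2 * B * t) ^ (n + 1)))) := by
    have hc : Continuous fun η : ℝ => 2 ^ n * (√(F 0 + η) + (2 * B * t) ^ (n + 1)) := by fun_prop
    have := hc.tendsto 0
    rw [add_zero] at this
    exact this.mono_left nhdsWithin_le_nhds
  exact ge_of_tendsto hlim (by filter_upwards [self_mem_nhdsWithin] with η hη using main η hη)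

/-! ### Propagation of the regularized moments -/

theorem IsTanhWeight.re_inner_pow_neg_I_smul {d : ℕ} {e : Rd d} {δ : ℝ} {w w' : Rd d →ᵇ ℂ}
    (hw : IsTanhWeight e δ w w') (r : ℕ) (ψ φ : L2Rd d) :
    (inner ℂ (mulOp (w ^ r) ψ) (mulOp (w ^ r) (-(Complex.I • φ)))).re =
      -(inner ℂ φ (mulOp (w ^ (r + r)) ψ)).im := by
  have h := hw.inner_pow_add r r 1 φ ψ
  rw [mul_one, mul_one] at h
  rw [h, map_neg, map_smul, inner_neg_right, inner_smul_right,
    ← inner_conj_symm (mulOp (w ^ r) φ) (mulOp (w ^ r) ψ), Complex.conj_im]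
  simp

/-- The constant is chosen before `ψ`, `j`, `δ` and the weight; this uniformity is what permits the
limit `δ → 0`. -/
theorem exists_norm_mulOp_pow_unitaryGroup_le {d : ℕ} {V : Rd d → ℝ} {W : Rd d →ᵇ ℂ}
    (hW : ∀ x, W x = V x) {n : ℕ} (hs : SmoothBound n W) :
    ∃ C : ℝ, 0 ≤ C ∧ ∀ ψ : L2Rd d, InSobolev (2 * (n + 1 : ℕ) : ℝ) ψ →
      ∀ (j : Fin d) (δ : ℝ) (w w' : Rd d →ᵇ ℂ), IsTanhWeight (stdVec j) δ w w' →
      (∀ i, i ≠ j → HasDirDeriv (stdVec i) w 0) → ∀ t : ℝ, 0 ≤ t →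
      ‖mulOp (w ^ (n + 1)) (unitaryGroup (schrodingerOp V) t ψ)‖ ≤
        2 ^ n * (‖mulOp (w ^ (n + 1)) ψ‖ +
          C * t ^ (n + 1) * sumNormPow (schrodingerOp V) (n + 1) ψ) := by
  -- `k = ⌈(n+1)/2⌉`: enough powers of `H` to control `n + 1` derivatives, and few enough that `n`
  -- derivatives of `V` suffice.
  obtain ⟨k, hk1, hk2, hk3⟩ : ∃ k, 1 ≤ k ∧ 2 * k - 2 ≤ n ∧ n + 1 ≤ 2 * k :=
    ⟨(n + 2) / 2, by omega, by omega, by omega⟩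
  have hU := isUnitaryGroupOf_schrodingerOp hW
  set U := unitaryGroup (schrodingerOp V) with hUdef
  obtain ⟨C₁, hC₁0, hC₁⟩ := exists_sobolevBound_of_mem_powDomain hW (hs.anti hk2)
  obtain ⟨C₂, hC₂0, hC₂⟩ := exists_interpolation n
  refine ⟨2 ^ (n + 1) * (C₂ * ((n + 2) * C₁)), by positivity, ?_⟩
  intro ψ hψ j δ w w' hw hwi t ht
  set S := sumNormPow (schrodingerOp V) (n + 1) ψ with hS
  have hS0 : 0 ≤ S := sumNormPow_nonneg _ _
  have hdom : ψ ∈ powDomain (schrodingerOp V) k := by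
    obtain ⟨K, hK⟩ := hψ.exists_sobolevBound
    exact mem_powDomain_schrodingerOp hW (hs.anti hk2) (hK.anti (by omega))
  have hreg : ∀ s, SobolevBound (2 * k) (U s ψ) (C₁ * S) := fun s =>
    (hC₁ _ (hU.map_mem_powDomain hdom s)).mono (by
      rw [hU.sumNormPow_map hdom s]
      exact mul_le_mul_of_nonneg_left (sumNormPow_mono (by omega) ψ) hC₁0)
  obtain ⟨φ, hφ, -⟩ : ∃ φ, (ψ, φ) ∈ (schrodingerOp V).graph ∧
      φ ∈ powDomain (schrodingerOp V) 0 := mem_powDomain_succ_iff.mp (powDomain_anti hk1 hdom)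
  choose v hv0 hv1 hv2 using fun s => ((hreg s).anti hk3).exists_seq j
  let E : ℝ := C₂ * ((n + 2) * C₁) * S
  have hE0 : 0 ≤ E := by positivity
  have hb : ∀ s, ‖mulOp (w ^ n) (v s 1)‖ ^ (n + 1) ≤ E * ‖mulOp (w ^ (n + 1)) (U s ψ)‖ ^ n := by
    intro s
    have h := hC₂ (fun r l => ‖mulOp (w ^ r) (v s l)‖) (fun r l => norm_nonneg _)
      (fun r l hl => hw.norm_sq_deriv_le (hv1 s l (by omega)) (hv1 s (l + 1) (by omega)) r)
      (fun r => hw.norm_sq_pow_le _ r)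
      (fun r l hl => hw.uncertainty (hv1 s l (by omega)) r)
    have hsum : ∑ l ∈ Finset.range (n + 2), ‖mulOp (w ^ 0) (v s l)‖ ≤ (n + 2) * (C₁ * S) := by
      have := Finset.sum_le_card_nsmul (Finset.range (n + 2)) (fun l => ‖mulOp (w ^ 0) (v s l)‖)
        (C₁ * S) fun l hl => by
          rw [pow_zero, mulOp_one]
          exact hv2 s l (Nat.lt_succ_iff.mp (Finset.mem_range.mp hl))
      simpa using this
    simp only [hv0] at h
    refine h.trans ?_
    calc C₂ * (‖mulOp (w ^ (n + 1)) (U s ψ)‖ ^ n *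
          ∑ l ∈ Finset.range (n + 2), ‖mulOp (w ^ 0) (v s l)‖) ≤
        C₂ * (‖mulOp (w ^ (n + 1)) (U s ψ)‖ ^ n * ((n + 2) * (C₁ * S))) := by gcongr
      _ = _ := by ring
  let F : ℝ → ℝ := fun s => ‖mulOp (w ^ (n + 1)) (U s ψ)‖ ^ 2
  have hF : ∀ s, HasDerivAt F (2 * (inner ℂ (mulOp (w ^ (n + 1)) (U s ψ))
      (mulOp (w ^ (n + 1)) (U s (-(Complex.I • φ))))).re) s := fun s =>
    hasDerivAt_norm_sq_of_complex (((mulOp (w ^ (n + 1))).restrictScalars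
      ℝ).hasFDerivAt.comp_hasDerivAt s (hU.hasDerivAt_of_mem_graph hφ s))
  have hsqrt : ∀ s, √(F s) = ‖mulOp (w ^ (n + 1)) (U s ψ)‖ := fun s => Real.sqrt_sq (norm_nonneg _)
  have hBpow : (E ^ (1 / ((n + 1 : ℕ) : ℝ))) ^ (n + 1) = E := by
    rw [one_div]
    exact Real.rpow_inv_natCast_pow hE0 (Nat.succ_ne_zero n)
  -- With `B = E^{1/(n+1)}`, the term `(2Bt)^{n+1}` equals `2^{n+1} E t^{n+1}`, which is linear in
  -- the sum of the `‖H^k ψ‖`.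
  have h := sqrt_le_of_deriv_le (F := F) (b := fun s => ‖mulOp (w ^ n) (v s 1)‖) (n := n)
    (B := E ^ (1 / ((n + 1 : ℕ) : ℝ))) (fun s => sq_nonneg _) hF (fun s => norm_nonneg _)
    (Real.rpow_nonneg hE0 _) (fun s => ?_) (fun s => ?_) ht
  · rw [hsqrt, hsqrt, hU.map_zero, mul_assoc, mul_pow, mul_pow, hBpow] at h
    refine h.trans (le_of_eq ?_)
    simp only [E]
    ring
  · rw [map_neg, map_smul, hw.re_inner_pow_neg_I_smul]
    have hd : HasD (stdVec j) (U s ψ) (v s 1) := by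
      have := hv1 s 0 (Nat.succ_pos n)
      rwa [hv0] at this
    have h1 := abs_im_inner_schrodinger_le hW (hU.mem_graph_map hφ s)
      ((hreg s).anti (by omega)) hw hwi hd n
    rw [hsqrt]
    have h2 := neg_abs_le (inner ℂ (U s φ) (mulOp (w ^ (n + 1 + (n + 1))) (U s ψ))).im
    nlinarith
  · rw [hBpow, hsqrt]
    exact hb s

/-! ### Moments -/

theorem momentNorm_eq {d : ℕ} (m : ℕ) (ψ : L2Rd d) :
    momentNorm m ψ =
      (∑ j, eLpNorm (fun x : Rd d => (x j : ℂ) ^ m * ψ x) 2 volume ^ (2 : ℝ)) ^ (1 / (2 : ℝ)) := by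
  have hm : ∀ j, AEStronglyMeasurable (fun x : Rd d => (x j : ℂ) ^ m * ψ x) volume := fun j =>
    (Continuous.aestronglyMeasurable (by fun_prop)).mul (Lp.aestronglyMeasurable ψ)
  have h2 : ∀ f : Rd d → ℂ, eLpNorm f 2 volume ^ (2 : ℝ) = ∫⁻ x, ‖f x‖ₑ ^ (2 : ℝ) := fun f => by
    rw [eLpNorm_eq_lintegral_rpow_enorm_toReal two_ne_zero ENNReal.ofNat_ne_top,
      ENNReal.toReal_ofNat, ← ENNReal.rpow_mul]
    norm_num
  simp only [h2]
  rw [← lintegral_finsetSum' _ fun j _ => (hm j).enorm.pow_const _]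
  unfold momentNorm
  rw [eLpNorm_eq_lintegral_rpow_enorm_toReal two_ne_zero ENNReal.ofNat_ne_top,
    ENNReal.toReal_ofNat]
  congr 1
  refine lintegral_congr fun x => ?_
  have h3 : ∀ (ι : Type) [Fintype ι] (z : EuclideanSpace ℂ ι),
      ‖z‖ₑ ^ (2 : ℝ) = ∑ j, ‖z j‖ₑ ^ (2 : ℝ) := by
    intro ι _ z
    have e : ∀ (G : Type) [NormedAddCommGroup G] (y : G),
        ‖y‖ₑ ^ (2 : ℝ) = ENNReal.ofReal (‖y‖ ^ 2) := fun G _ y => by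
      rw [← ofReal_norm, ENNReal.rpow_two, ENNReal.ofReal_pow (norm_nonneg _)]
    simp only [e]
    rw [EuclideanSpace.norm_sq_eq, ENNReal.ofReal_sum_of_nonneg fun j _ => sq_nonneg _]
  rw [h3]

/-- Fatou's lemma along `δ = 1/(n+1)`. Finiteness of the moment is not presupposed, so it can come
out as a conclusion. -/
theorem eLpNorm_coord_pow_le_of_tanhWeight {d : ℕ} (j : Fin d) (m : ℕ) (ψ : L2Rd d) {c : ℝ≥0∞}
    (h : ∀ δ : ℝ, 0 < δ → δ ≤ 1 → ‖mulOp (tanhWeight j δ ^ m) ψ‖ₑ ≤ c) :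
    eLpNorm (fun x : Rd d => (x j : ℂ) ^ m * ψ x) 2 volume ≤ c := by
  have hδ : Tendsto (fun n : ℕ => 1 / ((n : ℝ) + 1)) atTop (𝓝[≠] 0) :=
    tendsto_nhdsWithin_iff.mpr ⟨tendsto_one_div_add_atTop_nhds_zero_nat,
      Eventually.of_forall fun n => by
        have : (0 : ℝ) < 1 / ((n : ℝ) + 1) := by positivity
        exact this.ne'⟩
  refine (Lp.eLpNorm_lim_le_liminf_eLpNorm
    (f := fun n : ℕ => mulOp (tanhWeight j (1 / ((n : ℝ) + 1)) ^ m) ψ)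
    (fun n => Lp.aestronglyMeasurable _) _ ?_).trans ?_
  · filter_upwards [ae_all_iff.mpr fun n : ℕ =>
      coeFn_mulOp (tanhWeight j (1 / ((n : ℝ) + 1)) ^ m) ψ] with x hx
    simp only [hx, BoundedContinuousFunction.pow_apply]
    exact (((tendsto_tanhWeight j x).comp hδ).pow m).mul_const _
  · refine liminf_le_of_frequently_le' (Frequently.of_forall fun n => ?_)
    rw [← Lp.enorm_def]
    refine h _ (by positivity) ?_
    rw [div_le_one (by positivity)]
    linarith [Nat.cast_nonneg (α := ℝ) n]

theorem enorm_mulOp_tanhWeight_pow_le {d : ℕ} (j : Fin d) (m : ℕ) {δ : ℝ} (hδ : 0 < δ)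
    (ψ : L2Rd d) : ‖mulOp (tanhWeight j δ ^ m) ψ‖ₑ ≤
      eLpNorm (fun x : Rd d => (x j : ℂ) ^ m * ψ x) 2 volume := by
  rw [Lp.enorm_def, eLpNorm_congr_ae (coeFn_mulOp _ _)]
  refine eLpNorm_mono fun x => ?_
  rw [norm_mul, norm_mul, BoundedContinuousFunction.pow_apply, norm_pow, norm_pow,
    Complex.norm_real, Real.norm_eq_abs]
  exact mul_le_mul_of_nonneg_right
    (pow_le_pow_left₀ (norm_nonneg _) (norm_tanhWeight_le j hδ x) m) (norm_nonneg _)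

theorem momentNorm_le_of_eLpNorm_le {d m : ℕ} {ψ χ : L2Rd d} {a b : ℝ≥0∞}
    (h : ∀ j : Fin d, eLpNorm (fun x : Rd d => (x j : ℂ) ^ m * ψ x) 2 volume ≤
      a * (eLpNorm (fun x : Rd d => (x j : ℂ) ^ m * χ x) 2 volume + b)) :
    momentNorm m ψ ≤ a * (momentNorm m χ + d * b) := by
  rw [momentNorm_eq, momentNorm_eq]
  set c : Fin d → ℝ≥0∞ := fun j => eLpNorm (fun x : Rd d => (x j : ℂ) ^ m * χ x) 2 volume
  -- The constant vector has `ℓ²` norm `√d b`, and `√d ≤ d` also for `d = 0`.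
  have hd : (∑ _j : Fin d, b ^ (2 : ℝ)) ^ (1 / (2 : ℝ)) ≤ d * b := by
    rw [Finset.sum_const, Finset.card_univ, Fintype.card_fin, nsmul_eq_mul,
      ENNReal.mul_rpow_of_nonneg _ _ (by norm_num), ← ENNReal.rpow_mul]
    norm_num
    gcongr
    rcases Nat.eq_zero_or_pos d with rfl | hd
    · simp
    · refine (ENNReal.rpow_le_rpow_of_exponent_le (by exact_mod_cast hd) ?_).trans
        (ENNReal.rpow_one _).le
      norm_num
  calc (∑ j, eLpNorm (fun x : Rd d => (x j : ℂ) ^ m * ψ x) 2 volume ^ (2 : ℝ)) ^ (1 / (2 : ℝ))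
      ≤ (∑ j, (a * (c j + b)) ^ (2 : ℝ)) ^ (1 / (2 : ℝ)) := by
        gcongr with j
        exact h j
    _ = a * (∑ j, (c j + b) ^ (2 : ℝ)) ^ (1 / (2 : ℝ)) := by
        simp only [ENNReal.mul_rpow_of_nonneg _ _ (by norm_num : (0 : ℝ) ≤ 2)]
        rw [← Finset.mul_sum, ENNReal.mul_rpow_of_nonneg _ _ (by norm_num), ← ENNReal.rpow_mul]
        norm_num
    _ ≤ _ := by
        gcongr
        exact (ENNReal.Lp_add_le _ _ _ one_le_two).trans (by gcongr)

theorem mainTheorem10 (d m : ℕ) (hm : 1 ≤ m) (V : Rd d → ℝ)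
    (hV : ContDiff ℝ ((m - 1 : ℕ) : ℕ∞) V)
    (hVb : ∀ k < m, ∃ B : ℝ, ∀ x, ‖iteratedFDeriv ℝ k V x‖ ≤ B) :
    IsUnitaryGroupOf (schrodingerOp V) (unitaryGroup (schrodingerOp V)) ∧
    ∃ C : ℝ, 0 ≤ C ∧ ∀ ψ : L2Rd d, InSobolev (2 * m : ℝ) ψ → ∀ t : ℝ, 0 ≤ t →
      momentNorm m (unitaryGroup (schrodingerOp V) t ψ) ≤
        2 ^ (m - 1) * (momentNorm m ψ +
          ENNReal.ofReal (C * t ^ m * sumNormPow (schrodingerOp V) m ψ)) := by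
  obtain ⟨n, rfl⟩ : ∃ n, m = n + 1 := ⟨m - 1, by omega⟩
  rw [Nat.add_sub_cancel] at hV ⊢
  have hVn : ContDiff ℝ n V := hV
  obtain ⟨B, hB⟩ := hVb 0 (Nat.succ_pos n)
  simp only [norm_iteratedFDeriv_zero] at hB
  let f : Rd d → ℂ := Complex.ofRealCLM ∘ V
  have hf : ContDiff ℝ n f := Complex.ofRealCLM.contDiff.comp hVn
  let W : Rd d →ᵇ ℂ := BoundedContinuousFunction.ofNormedAddCommGroup f hf.continuous B
    (fun x => by
      change ‖((V x : ℝ) : ℂ)‖ ≤ B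
      rw [Complex.norm_real]
      exact hB x)
  have hW : ∀ x, W x = V x := fun x => rfl
  have hs : SmoothBound n W := by
    refine smoothBound_of_contDiff hf (fun k hk => ?_) (g := W) fun x => rfl
    obtain ⟨B', hB'⟩ := hVb k (Nat.lt_succ_of_le hk)
    exact ⟨‖Complex.ofRealCLM‖ * B', fun x =>
      (Complex.ofRealCLM.norm_iteratedFDeriv_comp_left hVn.contDiffAt
        (by exact_mod_cast hk)).trans (mul_le_mul_of_nonneg_left (hB' x) (norm_nonneg _))⟩
  refine ⟨isUnitaryGroupOf_schrodingerOp hW, ?_⟩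
  obtain ⟨C, hC0, hC⟩ := exists_norm_mulOp_pow_unitaryGroup_le hW hs
  -- The factor `d` comes from combining the `d` coordinate estimates by Minkowski's inequality in
  -- `ℓ²`.
  refine ⟨d * C, by positivity, fun ψ hψ t ht => ?_⟩
  have hS0 := sumNormPow_nonneg (A := schrodingerOp V) (n + 1) ψ
  have e : ENNReal.ofReal (d * C * t ^ (n + 1) * sumNormPow (schrodingerOp V) (n + 1) ψ) =
      d * ENNReal.ofReal (C * t ^ (n + 1) * sumNormPow (schrodingerOp V) (n + 1) ψ) := by
    rw [mul_assoc, mul_assoc, ENNReal.ofReal_mul (Nat.cast_nonneg d), ENNReal.ofReal_natCast,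
      mul_assoc]
  rw [e]
  refine momentNorm_le_of_eLpNorm_le fun j =>
    eLpNorm_coord_pow_le_of_tanhWeight j (n + 1) _ fun δ hδ hδ1 => ?_
  have h := hC ψ hψ j δ _ _ (isTanhWeight_tanhWeight j hδ hδ1)
    (fun i hi => hasDirDeriv_tanhWeight_of_ne hi δ) t ht
  have h' := ENNReal.ofReal_le_ofReal h
  rw [ofReal_norm, ENNReal.ofReal_mul (by positivity),
    ENNReal.ofReal_add (norm_nonneg _) (by positivity), ofReal_norm,
    ENNReal.ofReal_pow zero_le_two, ENNReal.ofReal_ofNat] at h'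
  refine h'.trans ?_
  gcongr
  exact enorm_mulOp_tanhWeight_pow_le j (n + 1) hδ ψ
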